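/- Let $H$ be a finite-dimensional real Lie group with identity $e$, Lie algebra $\mathfrak h=T_eH$ (bracket of left-invariant vector fields) and dual $\mathfrak h^*$. Let $(P,\omega_P)$ be a finite-dimensional symplectic manifold on which $H$ acts smoothly from the left, preserving $\omega_P$. Let $B$ be a smooth closed two-form on $H\times P$ that is invariant under the diagonal action $h\cdot(g,p)=(hg,h\cdot p)$ and whose restriction to each slice $\{g\}\times P$ is $-\omega_P$. Let $\phi:H\times P\to\mathfrak h^*$ be a smooth map with $\mathbf i_{\xi_{H\times P}}B=\mathbf d\langle\phi,\xi\rangle$ for all $\xi\in\mathfrak h$, where $\xi_{H\times P}$ is the fundamental vector field of $\xi$ for the diagonal action. On $T^*H\times P$ consider $\Omega=\omega_{\rm can}-B$, where $\omega_{\rm can}=-\mathbf d\theta$ is the canonical symplectic form of $T^*H$ ($\theta$ being the canonical one-form) and $B$ is pulled back along $(\alpha_g,p)\mapsto(g,p)$. Let $$\Lambda:T^*H\times P\to H\times\mathfrak h^*\times P,\qquad \Lambda(\alpha_g,p)=(g,\;T^*L_g(\alpha_g),\;g^{-1}\cdot p),$$ put $\Omega_{\rm body}=\Lambda_*\Omega$,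 and let $\mathcal S(g,\mu,x)=(g,\mu-\phi(e,x),x)$ on $H\times\mathfrak h^*\times P$. For a symplectic form $\omega$ let $\{F,K\}=X_K(F)$, where $\mathbf i_{X_K}\omega=\mathbf dK$; write $\{\cdot,\cdot\}_P$ for the bracket of $\omega_P$. For functions $f$, $k$ on $\mathfrak h^*$ let $\frac{\delta f}{\delta\mu}\in\mathfrak h$ be the functional derivative and $\{f,k\}_{\rm l.p}(\mu)=-\big\langle\mu,\big[\frac{\delta f}{\delta\mu},\frac{\delta k}{\delta\mu}\big]\big\rangle$. Let $\Sigma$ be the non-equivariance two-cocycle of $\phi$: for $\xi,\eta\in\mathfrak h$, $\Sigma(\xi,\eta)(h,p)$ is the derivative at $g=e$ in the direction $\xi$ of $g\mapsto-\langle\phi(gh,g\cdot p),\eta\rangle+\langle\phi(h,p),\mathrm{Ad}_{g^{-1}}\eta\rangle$. Then $\mathcal S_*\Omega_{\rm body}$ is a symplectic form on $H\times\mathfrak h^*\times P$, and it is invariant under the action $h\cdot(g,\mu,x)=(hg,\mu,x)$ of $H$. The bracket that it induces on the quotient $\mathfrak h^*\times P$, characterized by $\{f,k\}\circ\pi=\{f\circ\pi,k\circ\pi\}$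 with $\pi(g,\mu,x)=(\mu,x)$, is the natural bracket: for all smooth $f$, $k$ on $\mathfrak h^*\times P$ and all $(\mu,x)$, $$\{f,k\}_\Sigma(\mu,x)=\{f(\cdot,x),k(\cdot,x)\}_{\rm l.p}(\mu)+\{f(\mu,\cdot),k(\mu,\cdot)\}_P(x)+\Sigma\Big(\frac{\delta f}{\delta\mu},\frac{\delta k}{\delta\mu}\Big)(e,x),$$ with $\frac{\delta f}{\delta\mu}$, $\frac{\delta k}{\delta\mu}$ taken at $(\mu,x)$ for fixed $x$. -/

import Mathlib

open scoped Manifold ContDiff Bundle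

noncomputable section

namespace BodyReduction

/-! ### Differential forms on manifolds without boundary -/

section Forms

variable {E : Type*} [NormedAddCommGroup E] [NormedSpace ℝ E]
  {X : Type*} [TopologicalSpace X] (I : ModelWithCorners ℝ E X)
  {M : Type*} [TopologicalSpace M] [ChartedSpace X M]
  {F : Type*} [NormedAddCommGroup F] [NormedSpace ℝ F]
  {Y : Type*} [TopologicalSpace Y] (J : ModelWithCorners ℝ F Y)
  {N : Type*} [TopologicalSpace N] [ChartedSpace Y N]

/-- A (not necessarily smooth) differential `k`-form on `M`. -/
abbrev DiffForm (M : Type*) [TopologicalSpace M] [ChartedSpace X M] (k : ℕ) : Type _ :=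
  ∀ x : M, TangentSpace I x [⋀^Fin k]→L[ℝ] ℝ

variable {k : ℕ}

/-- The pull-back `f^* Ω`. -/
def pullback (f : M → N) (Ω : DiffForm J N k) : DiffForm I M k :=
  fun x => (Ω (f x)).compContinuousLinearMap (mfderiv I J f x)

/-- The push-forward `e_* Ω = (e⁻¹)^* Ω` along a bijection (used for diffeomorphisms). -/
def pushforward (e : M ≃ N) (Ω : DiffForm I M k) : DiffForm J N k :=
  pullback J I e.symm Ω

/-- The form `Ω` read in the chart around `x₀`. -/
def chartRep (Ω : DiffForm I M k) (x₀ : M) : E → E [⋀^Fin k]→L[ℝ] ℝ :=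
  pullback 𝓘(ℝ, E) I (extChartAt I x₀).symm Ω

/-- `Ω` is smooth: its expressions in all preferred charts are `C^∞`. -/
def IsSmoothForm (Ω : DiffForm I M k) : Prop :=
  ∀ x₀ : M, ContDiffOn ℝ ∞ (chartRep I Ω x₀) (extChartAt I x₀).target

/-- The exterior derivative, computed at `x` in the chart around `x`. -/
def extD (Ω : DiffForm I M k) : DiffForm I M (k + 1) := fun x =>
  (extDeriv (chartRep I Ω x) (extChartAt I x x)).compContinuousLinearMap
    (mfderiv I 𝓘(ℝ, E) (extChartAt I x) x)

/-- `Ω` is a symplectic form. -/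
structure IsSymplectic (Ω : DiffForm I M 2) : Prop where
  smooth : IsSmoothForm I Ω
  closed : ∀ x, extD I Ω x = 0
  nondegenerate : ∀ (x : M) (v : TangentSpace I x), (∀ w : TangentSpace I x, Ω x ![v, w] = 0) → v = 0

/-- The value at `x` of the Hamiltonian vector field `X_K`, given by `i_{X_K} Ω = dK`. It exists and
is unique when `Ω` is nondegenerate, see `hamVec_spec` and `hamVec_unique`. -/
def hamVec (Ω : DiffForm I M 2) (K : M → ℝ) (x : M) : TangentSpace I x :=
  Classical.epsilon fun v => ∀ w : TangentSpace I x, Ω x ![v, w] = mvfderiv I K x w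

/-- The bracket `{F, K} = X_K(F)` associated with a symplectic form `Ω`. -/
def poissonBracket (Ω : DiffForm I M 2) (F K : M → ℝ) (x : M) : ℝ :=
  mvfderiv I F x (hamVec I Ω K x)

variable {I}

lemma update_zero {V : Type*} (v w a : V) : Function.update ![v, w] 0 a = ![a, w] := by
  ext i; fin_cases i <;> rfl

lemma update_one {V : Type*} (v w a : V) : Function.update ![v, w] 1 a = ![v, a] := by
  ext i; fin_cases i <;> rfl

lemma hamVec_spec [FiniteDimensional ℝ E] {Ω : DiffForm I M 2} (hΩ : IsSymplectic I Ω)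
    (K : M → ℝ) (x : M) (w : TangentSpace I x) :
    Ω x ![hamVec I Ω K x, w] = mvfderiv I K x w := by
  have key : ∃ v : TangentSpace I x, ∀ w : TangentSpace I x,
      Ω x ![v, w] = mvfderiv I K x w := by
    have : FiniteDimensional ℝ (TangentSpace I x) := inferInstanceAs (FiniteDimensional ℝ E)
    let T : TangentSpace I x →ₗ[ℝ] Module.Dual ℝ (TangentSpace I x) :=
      LinearMap.mk₂ ℝ (fun v w => Ω x ![v, w])
        (fun v v' w => by
          have h := (Ω x).map_update_add ![v, w] 0 v v'
          rwa [update_zero, update_zero, update_zero] at h)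
        (fun c v w => by
          have h := (Ω x).map_update_smul ![v, w] 0 c v
          rwa [update_zero, update_zero] at h)
        (fun v w w' => by
          have h := (Ω x).map_update_add ![v, w] 1 w w'
          rwa [update_one, update_one, update_one] at h)
        (fun c v w => by
          have h := (Ω x).map_update_smul ![v, w] 1 c w
          rwa [update_one, update_one] at h)
    have hT : Function.Injective T := by
      rw [← LinearMap.ker_eq_bot, LinearMap.ker_eq_bot']
      intro v hv
      exact hΩ.nondegenerate x v fun w => LinearMap.congr_fun hv w
    have hs : Function.Surjective T :=
      (LinearMap.injective_iff_surjective_of_finrank_eq_finrank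
        (Subspace.dual_finrank_eq).symm).1 hT
    obtain ⟨v, hv⟩ := hs (mvfderiv I K x).toLinearMap
    exact ⟨v, fun w => LinearMap.congr_fun hv w⟩
  exact Classical.epsilon_spec key w

lemma hamVec_unique [FiniteDimensional ℝ E] {Ω : DiffForm I M 2} (hΩ : IsSymplectic I Ω)
    (K : M → ℝ) (x : M) (v : TangentSpace I x)
    (hv : ∀ w : TangentSpace I x, Ω x ![v, w] = mvfderiv I K x w) : v = hamVec I Ω K x := by
  rw [← sub_eq_zero]
  refine hΩ.nondegenerate x _ fun w => ?_
  have h := (Ω x).map_update_sub ![v, w] 0 v (hamVec I Ω K x)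
  rw [update_zero, update_zero, update_zero] at h
  rw [h, hv w, hamVec_spec hΩ K x w, sub_self]

end Forms

/-! ### The cotangent bundle and its canonical form -/

section Cotangent

variable {E : Type*} [NormedAddCommGroup E] [NormedSpace ℝ E]
  {X : Type*} [TopologicalSpace X] (I : ModelWithCorners ℝ E X)
  (M : Type*) [TopologicalSpace M] [ChartedSpace X M] [IsManifold I ∞ M]

/-- The cotangent bundle `T^*M`; its points are `⟨g, α⟩` with `α` in the dual of `T_g M`. -/
abbrev CotangentBundle : Type _ :=
  Bundle.TotalSpace (E →L[ℝ] ℝ) (fun g : M => TangentSpace I g →L[ℝ] ℝ)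

/-- The model with corners of `T^*M`. -/
abbrev cotangentModel : ModelWithCorners ℝ (E × (E →L[ℝ] ℝ)) (ModelProd X (E →L[ℝ] ℝ)) :=
  I.prod 𝓘(ℝ, E →L[ℝ] ℝ)

/-- The canonical one-form `θ`: `θ(α)(w) = α(Tπ(w))` with `π : T^*M → M` the projection. -/
def canonicalOneForm : DiffForm (cotangentModel I) (CotangentBundle I M) 1 := fun α =>
  ContinuousAlternatingMap.ofSubsingleton ℝ (TangentSpace (cotangentModel I) α) ℝ (0 : Fin 1)
    (α.snd.comp (mfderiv (cotangentModel I) I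
      (fun β : CotangentBundle I M => β.proj) α))

/-- The canonical symplectic form `ω_can = -dθ` (that is, `dq ∧ dp`). -/
def canonicalForm : DiffForm (cotangentModel I) (CotangentBundle I M) 2 :=
  fun α => -extD (cotangentModel I) (canonicalOneForm I M) α

end Cotangent

/-! ### A Lie group `H` coupled to a symplectic manifold `P`

The Lie algebra `𝔥 = GroupLieAlgebra I H` is the tangent space at the identity, whose underlying
vector space is the model space `E`, with the bracket of left-invariant vector fields. -/

section LieGroup

variable {E : Type*} [NormedAddCommGroup E] [NormedSpace ℝ E]
  {X : Type*} [TopologicalSpace X] (I : ModelWithCorners ℝ E X)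
  {H : Type*} [TopologicalSpace H] [ChartedSpace X H] [Group H]

/-- The dual `𝔥^*` of the Lie algebra of `H`, normed as the dual of the model space of `H`. -/
abbrev LieDual (_I : ModelWithCorners ℝ E X) (H : Type*) [TopologicalSpace H] [ChartedSpace X H]
    [Group H] : Type _ := E →L[ℝ] ℝ

/-- The tangent map `T_1 L_g : 𝔥 → T_g H` of left translation. -/
def leftTangent (g : H) : GroupLieAlgebra I H →L[ℝ] TangentSpace I g :=
  (mfderiv I I (fun h : H => g * h) (1 : H) : E →L[ℝ] E)

/-- The tangent map `T_g L_{g⁻¹} : T_g H → 𝔥` of left translation. -/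
def leftTangentInv (g : H) : TangentSpace I g →L[ℝ] GroupLieAlgebra I H :=
  (mfderiv I I (fun h : H => g⁻¹ * h) g : E →L[ℝ] E)

/-- The adjoint action `Ad_g` of `H` on `𝔥`. -/
def Ad (g : H) : GroupLieAlgebra I H →L[ℝ] GroupLieAlgebra I H :=
  (mfderiv I I (fun h : H => g * h * g⁻¹) (1 : H) : E →L[ℝ] E)

/-- The (left) coadjoint action `⟨Ad^*_g ν, η⟩ = ⟨ν, Ad_{g⁻¹} η⟩` of `H` on `𝔥^*`. -/
def coAd (g : H) (ν : LieDual I H) : LieDual I H :=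
  ContinuousLinearMap.comp (M₁ := E) (M₂ := E) ν (Ad I g⁻¹)

/-- The functional derivative `δf/δμ ∈ 𝔥` of a function on `𝔥^*` at `μ`: the element with
`⟨ρ, δf/δμ⟩ = Df(μ) · ρ` for all `ρ ∈ 𝔥^*`, see `funDeriv_spec`. -/
def funDeriv (f : LieDual I H → ℝ) (μ : LieDual I H) : GroupLieAlgebra I H :=
  Classical.epsilon (α := E) fun ξ => ∀ ρ : E →L[ℝ] ℝ, ρ ξ = fderiv ℝ f μ ρ

lemma funDeriv_spec [FiniteDimensional ℝ E] (f : LieDual I H → ℝ) (μ ρ : LieDual I H) :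
    ρ (funDeriv I f μ) = fderiv ℝ f μ ρ := by
  have key : ∃ ξ : E, ∀ ρ : E →L[ℝ] ℝ, ρ ξ = fderiv ℝ f μ ρ := by
    let c : Module.Dual ℝ E ≃ₗ[ℝ] (E →L[ℝ] ℝ) := LinearMap.toContinuousLinearMap
    obtain ⟨ξ, hξ⟩ := (Module.evalEquiv ℝ E).surjective ((fderiv ℝ f μ).toLinearMap ∘ₗ c.toLinearMap)
    refine ⟨ξ, fun ρ => ?_⟩
    have h := LinearMap.congr_fun hξ (c.symm ρ)
    simp only [Module.evalEquiv_apply, LinearMap.comp_apply, LinearEquiv.coe_coe,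
      LinearEquiv.apply_symm_apply, Module.Dual.eval_apply] at h
    exact h
  exact Classical.epsilon_spec key ρ

/-- The Lie-Poisson bracket `{f, k}(μ) = -⟨μ, [δf/δμ, δk/δμ]⟩` on `𝔥^*`, the one obtained from
`T^*H` by left translation. -/
def liePoissonBracket (f k : LieDual I H → ℝ) (μ : LieDual I H) : ℝ :=
  -μ (⁅funDeriv I f μ, funDeriv I k μ⁆ : GroupLieAlgebra I H)

end LieGroup

section Coupling

variable {E : Type*} [NormedAddCommGroup E] [NormedSpace ℝ E]
  {X : Type*} [TopologicalSpace X] (I : ModelWithCorners ℝ E X)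
  {H : Type*} [TopologicalSpace H] [ChartedSpace X H] [Group H]
  {F : Type*} [NormedAddCommGroup F] [NormedSpace ℝ F]
  {Y : Type*} [TopologicalSpace Y] (J : ModelWithCorners ℝ F Y)
  {P : Type*} [TopologicalSpace P] [ChartedSpace Y P] [MulAction H P]

/-- The diagonal action of `h` on `H × P`. -/
def diagAct (h : H) (z : H × P) : H × P := (h * z.1, h • z.2)

/-- The fundamental vector field `ξ_{H × P}` of the diagonal action on `H × P`: the derivative of
`h ↦ h · z` at the identity in the direction `ξ`. -/
def fundField (ξ : GroupLieAlgebra I H) (z : H × P) : TangentSpace (I.prod J) z :=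
  (mfderiv I (I.prod J) (fun h : H => diagAct h z) (1 : H) : E →L[ℝ] E × F) ξ

/-- `φ : H × P → 𝔥^*` is a (smooth) `ℬ𝔤`-potential of `B`: `i_{ξ_{H × P}} B = d⟨φ, ξ⟩`. -/
structure IsBgPotential (B : DiffForm (I.prod J) (H × P) 2) (φ : H × P → LieDual I H) : Prop where
  smooth : ContMDiff (I.prod J) 𝓘(ℝ, E →L[ℝ] ℝ) ∞ φ
  potential : ∀ (ξ : GroupLieAlgebra I H) (z : H × P) (w : TangentSpace (I.prod J) z),
    B z ![fundField I J ξ z, w] =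
      mvfderiv (I.prod J) (fun y : H × P => φ y ξ) z w

/-- The functions `Γ_{η,g}(h, p) = -⟨φ(gh, gp), η⟩ + ⟨Ad^*_g φ(h, p), η⟩`; the one-cocycle of `φ` is
`σ(g) · η = Γ_{η,g}`. -/
def oneCocycle (φ : H × P → LieDual I H) (g : H) (η : GroupLieAlgebra I H) (z : H × P) : ℝ :=
  -φ (diagAct g z) η + coAd I g (φ z) η

/-- The non-equivariance two-cocycle `Σ(ξ, η) = T_e σ_η(ξ)`, a function on `H × P`. -/
def twoCocycle (φ : H × P → LieDual I H) (ξ η : GroupLieAlgebra I H) (z : H × P) : ℝ :=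
  mvfderiv I (fun g : H => oneCocycle I φ g η z) (1 : H) ξ

/-- The natural bracket on `𝔥^* × P`:
`{f, k}_Σ = {f|𝔥^*, k|𝔥^*}_{l.p.} + {f|P, k|P}_P + Σ(δf/δμ, δk/δμ)`,
the function `Σ(ξ, η)` being evaluated at `(e, x)`. -/
def naturalBracket (ωP : DiffForm J P 2) (φ : H × P → LieDual I H)
    (f k : LieDual I H × P → ℝ) (y : LieDual I H × P) : ℝ :=
  liePoissonBracket I (H := H) (fun μ => f (μ, y.2)) (fun μ => k (μ, y.2)) y.1
    + poissonBracket J ωP (fun x => f (y.1, x)) (fun x => k (y.1, x)) y.2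
    + twoCocycle I φ (funDeriv I (fun μ => f (μ, y.2)) y.1) (funDeriv I (fun μ => k (μ, y.2)) y.1)
        ((1 : H), y.2)

/-- The shift map `S(g, μ, x) = (g, μ - φ(e, x), x)` of `H × 𝔥^* × P`. -/
def shiftMap (φ : H × P → LieDual I H) :
    (H × (LieDual I H × P)) ≃ (H × (LieDual I H × P)) where
  toFun z := (z.1, z.2.1 - φ (1, z.2.2), z.2.2)
  invFun z := (z.1, z.2.1 + φ (1, z.2.2), z.2.2)
  left_inv z := by simp
  right_inv z := by simp

/-- The model with corners of `H × 𝔥^* × P`. -/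
abbrev bodyModel : ModelWithCorners ℝ (E × ((E →L[ℝ] ℝ) × F)) (ModelProd X (ModelProd (E →L[ℝ] ℝ) Y)) :=
  I.prod (𝓘(ℝ, E →L[ℝ] ℝ).prod J)

/-- The action of `h` on `H × 𝔥^* × P`: left translation in the first factor. -/
def bodyAct (h : H) (z : H × (LieDual I H × P)) : H × (LieDual I H × P) := (h * z.1, z.2)

/-- `br` is the bracket on `(H × 𝔥^* × P)/H = 𝔥^* × P` induced by the symplectic form `Ω` on
`H × 𝔥^* × P`: `{f, k} ∘ π = {f ∘ π, k ∘ π}_Ω`, with `π(g, μ, x) = (μ, x)`. -/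
def IsInducedBracket (Ω : DiffForm (bodyModel I J) (H × (LieDual I H × P)) 2)
    (br : (LieDual I H × P → ℝ) → (LieDual I H × P → ℝ) → (LieDual I H × P → ℝ)) : Prop :=
  ∀ f k : LieDual I H × P → ℝ,
    ContMDiff (𝓘(ℝ, E →L[ℝ] ℝ).prod J) 𝓘(ℝ, ℝ) ∞ f →
    ContMDiff (𝓘(ℝ, E →L[ℝ] ℝ).prod J) 𝓘(ℝ, ℝ) ∞ k →
    br f k ∘ (Prod.snd : H × (LieDual I H × P) → LieDual I H × P) =
      poissonBracket (bodyModel I J) Ω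
        (f ∘ (Prod.snd : H × (LieDual I H × P) → LieDual I H × P))
        (k ∘ (Prod.snd : H × (LieDual I H × P) → LieDual I H × P))

variable [LieGroup I ∞ H]

/-- The magnetic form `Ω = ω_can - B` on `T^*H × P`, the two summands being pulled back along
`(α_g, p) ↦ α_g` and `(α_g, p) ↦ (g, p)`. -/
def magneticForm (B : DiffForm (I.prod J) (H × P) 2) :
    DiffForm ((cotangentModel I).prod J) (CotangentBundle I H × P) 2 := fun z =>
  pullback ((cotangentModel I).prod J) (cotangentModel I)
      (Prod.fst : CotangentBundle I H × P → CotangentBundle I H) (canonicalForm I H) z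
    - pullback ((cotangentModel I).prod J) (I.prod J)
      (fun y : CotangentBundle I H × P => (y.1.proj, y.2)) B z

variable {I} in
lemma leftTangent_comp_leftTangentInv (g : H) (v : TangentSpace I g) :
    leftTangent I g (leftTangentInv I g v) = v := by
  have h0 : (∞ : WithTop ℕ∞) ≠ 0 := by simp
  have h1 : (fun h : H => g * h) ∘ (fun h : H => g⁻¹ * h) = id := by
    ext h; simp
  have hc := mfderiv_comp (I := I) (I' := I) (I'' := I) (x := g)
    (g := fun h : H => g * h) (f := fun h : H => g⁻¹ * h)
    ((contMDiff_mul_left (I := I) (n := ∞)).contMDiffAt.mdifferentiableAt h0)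
    ((contMDiff_mul_left (I := I) (n := ∞)).contMDiffAt.mdifferentiableAt h0)
  rw [h1, mfderiv_id] at hc
  have h2 : g⁻¹ * g = 1 := inv_mul_cancel g
  rw [h2] at hc
  exact (DFunLike.congr_fun hc v).symm

variable {I} in
lemma leftTangentInv_comp_leftTangent (g : H) (v : GroupLieAlgebra I H) :
    leftTangentInv I g (leftTangent I g v) = v := by
  have h0 : (∞ : WithTop ℕ∞) ≠ 0 := by simp
  have h1 : (fun h : H => g⁻¹ * h) ∘ (fun h : H => g * h) = id := by
    ext h; simp
  have hc := mfderiv_comp (I := I) (I' := I) (I'' := I) (x := (1 : H))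
    (g := fun h : H => g⁻¹ * h) (f := fun h : H => g * h)
    ((contMDiff_mul_left (I := I) (n := ∞)).contMDiffAt.mdifferentiableAt h0)
    ((contMDiff_mul_left (I := I) (n := ∞)).contMDiffAt.mdifferentiableAt h0)
  rw [h1, mfderiv_id] at hc
  have h2 : g * 1 = g := mul_one g
  rw [h2] at hc
  exact (DFunLike.congr_fun hc v).symm

variable (H P) in
/-- Left trivialization `Λ(α_g, p) = (g, T^*L_g(α_g), g⁻¹ · p)` from `T^*H × P` to `H × 𝔥^* × P`,
with inverse `(g, μ, x) ↦ (μ ∘ T L_{g⁻¹}, g · x)`. -/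
def bodyMap : (CotangentBundle I H × P) ≃ (H × (LieDual I H × P)) where
  toFun z := (z.1.proj, ContinuousLinearMap.comp z.1.snd (leftTangent I z.1.proj), z.1.proj⁻¹ • z.2)
  invFun y := (⟨y.1, ContinuousLinearMap.comp (M₂ := E) y.2.1 (leftTangentInv I y.1)⟩,
    y.1 • y.2.2)
  left_inv z := by
    obtain ⟨⟨g, α⟩, p⟩ := z
    refine Prod.ext ?_ (smul_inv_smul g p)
    refine congrArg (Bundle.TotalSpace.mk g) ?_
    refine ContinuousLinearMap.ext fun v => ?_
    exact congrArg α (leftTangent_comp_leftTangentInv g v)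
  right_inv y := by
    obtain ⟨g, μ, x⟩ := y
    refine Prod.ext rfl (Prod.ext ?_ (inv_smul_smul g x))
    refine ContinuousLinearMap.ext fun v => ?_
    exact congrArg μ (leftTangentInv_comp_leftTangent g v)

/-- The form `Ω_body = Λ_* Ω` on `H × 𝔥^* × P`. -/
def bodyForm (B : DiffForm (I.prod J) (H × P) 2) :
    DiffForm (bodyModel I J) (H × (LieDual I H × P)) 2 :=
  pushforward ((cotangentModel I).prod J) (bodyModel I J) (bodyMap I H P) (magneticForm I J B)

/-- The shifted form `S_* Ω_body` on `H × 𝔥^* × P`. -/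
def shiftedForm (B : DiffForm (I.prod J) (H × P) 2) (φ : H × P → LieDual I H) :
    DiffForm (bodyModel I J) (H × (LieDual I H × P)) 2 :=
  pushforward (bodyModel I J) (bodyModel I J) (shiftMap I φ) (bodyForm I J B)

end Coupling

end BodyReduction

end

/-!
Pulled back along `(g, μ, x) ↦ (μ + φ(e, x))_g`, the canonical one-form becomes the left-trivialized
form `⟨μ + φ(e, x), g⁻¹ dg⟩`, and `B` is pulled back along `(g, x) ↦ (g, g • x)`. Both are invariant
under left translation, so `Ω = S_* Ω_body` is determined by its values at `g = e`. There the
Maurer-Cartan equation gives `-d⟨μ + φ(e, x), g⁻¹ dg⟩`, while `i_ξ B = d⟨φ, ξ⟩` and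
`Σ(ξ, η) = B(ξ, η) - ⟨φ, [ξ, η]⟩` give `B`. The derivatives of `φ` and the terms `⟨φ, [ξ, η]⟩`
cancel, leaving
`Ω((ξ, ρ, u), (η, σ, w)) = ⟨σ, ξ⟩ - ⟨ρ, η⟩ + ⟨μ, [ξ, η]⟩ - Σ(ξ, η)(e, x) + ω_P(u, w)`.
Pairing with `σ`, `w` and `η` in turn recovers `ξ`, `u` and `ρ` from `Ω((ξ, ρ, u), ·)`: this shows
that `Ω` is nondegenerate and computes its Hamiltonian vector fields.
-/

noncomputable section

namespace BodyReduction

open Set Filter Topology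

section AlternatingCalculus

variable {D : Type*} [NormedAddCommGroup D] [NormedSpace ℝ D]
  {E : Type*} [NormedAddCommGroup E] [NormedSpace ℝ E]
  {F : Type*} [NormedAddCommGroup F] [NormedSpace ℝ F]
  {G : Type*} [NormedAddCommGroup G] [NormedSpace ℝ G] {k : ℕ} {n : WithTop ℕ∞}

lemma continuous_alternatization : Continuous (ContinuousMultilinearMap.alternatization :
    ContinuousMultilinearMap ℝ (fun _ : Fin k => E) G →+ E [⋀^Fin k]→L[ℝ] G) := by
  refine ContinuousAlternatingMap.isEmbedding_toContinuousMultilinearMap.continuous_iff.2 ?_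
  refine continuous_finsetSum _ fun σ _ => Continuous.const_smul ?_ _
  exact (ContinuousMultilinearMap.domDomCongrₗᵢ ℝ E G σ).continuous

lemma exists_leftInverse_toContinuousMultilinearMap :
    ∃ R : ContinuousMultilinearMap ℝ (fun _ : Fin k => E) G →L[ℝ] E [⋀^Fin k]→L[ℝ] G,
      ∀ η : E [⋀^Fin k]→L[ℝ] G, R η.toContinuousMultilinearMap = η := by
  refine ⟨(k.factorial : ℝ)⁻¹ •
    ContinuousMultilinearMap.alternatization.toRealLinearMap continuous_alternatization,
    fun η => ?_⟩
  ext v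
  have hσ : ∀ σ : Equiv.Perm (Fin k), σ.sign • η (v ∘ σ) = η v := fun σ => by
    rw [show η (v ∘ σ) = σ.sign • η v from η.toAlternatingMap.map_perm v σ, smul_smul,
      Int.units_mul_self, one_smul]
  have hk : (k.factorial : ℝ) ≠ 0 := Nat.cast_ne_zero.2 k.factorial_ne_zero
  simp [ContinuousMultilinearMap.alternatization_apply_apply, hσ, Fintype.card_perm,
    ← Nat.cast_smul_eq_nsmul ℝ, smul_smul, hk]

lemma contDiffAt_compContinuousLinearMap {β : D → F [⋀^Fin k]→L[ℝ] G} {A : D → E →L[ℝ] F}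
    {x : D} (hβ : ContDiffAt ℝ n β x) (hA : ContDiffAt ℝ n A x) :
    ContDiffAt ℝ n (fun y => (β y).compContinuousLinearMap (A y)) x := by
  obtain ⟨R, hR⟩ := exists_leftInverse_toContinuousMultilinearMap (E := E) (G := G) (k := k)
  have hcomp : ContDiffAt ℝ n (fun y =>
      ContinuousMultilinearMap.compContinuousLinearMapContinuousMultilinear ℝ
        (fun _ : Fin k => E) (fun _ : Fin k => F) G (fun _ => A y)) x :=
    (ContinuousMultilinearMap.contDiff _).contDiffAt.comp x (contDiffAt_pi.2 fun _ => hA)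
  have hmul : ContDiffAt ℝ n (fun y => (β y).toContinuousMultilinearMap) x :=
    (ContinuousAlternatingMap.toContinuousMultilinearMapCLM (𝕜 := ℝ) (E := F) (ι := Fin k)
      (F := G) ℝ).contDiff.contDiffAt.comp x hβ
  exact (R.contDiff.contDiffAt.comp x (hcomp.clm_apply hmul)).congr_of_eventuallyEq
    (.of_forall fun y => (hR _).symm)

lemma contDiffAt_extDeriv {β : E → E [⋀^Fin k]→L[ℝ] ℝ} {x : E} (hβ : ContDiffAt ℝ ∞ β x) :
    ContDiffAt ℝ ∞ (extDeriv β) x := by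
  have halt : extDeriv β = fun y =>
      ContinuousAlternatingMap.alternatizeUncurryFinCLM ℝ E ℝ (fderiv ℝ β y) := rfl
  rw [halt]
  exact (ContinuousAlternatingMap.alternatizeUncurryFinCLM (n := k) ℝ E ℝ).contDiff.contDiffAt.comp
    x (hβ.fderiv_right (m := ∞) le_rfl)

lemma extDeriv_one_apply {β : E → E [⋀^Fin 1]→L[ℝ] G} {c : E} (h : DifferentiableAt ℝ β c)
    (v w : E) : extDeriv β c ![v, w]
      = fderiv ℝ (fun a => β a ![w]) c v - fderiv ℝ (fun a => β a ![v]) c w := by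
  have h₀ : Fin.removeNth 0 ![v, w] = ![w] := by ext i; fin_cases i; rfl
  have h₁ : Fin.removeNth 1 ![v, w] = ![v] := by ext i; fin_cases i; rfl
  rw [extDeriv_apply h, Fin.sum_univ_two, h₀, h₁]
  simp [sub_eq_add_neg]

lemma twoForm_swap (b : E [⋀^Fin 2]→L[ℝ] G) (v w : E) : b ![v, w] = -b ![w, v] := by
  have hswap : ![w, v] ∘ Equiv.swap (0 : Fin 2) 1 = ![v, w] := by
    ext i
    fin_cases i <;> rfl
  exact hswap ▸ b.map_swap ![w, v] (i := 0) (j := 1) (by decide)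

lemma twoForm_add_add (b : E [⋀^Fin 2]→L[ℝ] G) (v v' w w' : E) :
    b ![v + v', w + w'] = b ![v, w] + b ![v, w'] + (b ![v', w] + b ![v', w']) := by
  have hadd : ∀ u, b ![u, w + w'] = b ![u, w] + b ![u, w'] := fun u => by
    rw [twoForm_swap, b.vecCons_add, neg_add, ← twoForm_swap, ← twoForm_swap]
  rw [b.vecCons_add, hadd, hadd]

lemma fderiv_fderiv_comp_apply {g : F → G} {c : D → F} {c' : D →L[ℝ] F} {a : D}
    (hc : HasFDerivAt c c' a) (hg : ContDiffAt ℝ 2 g (c a)) (A : E →L[ℝ] F) (v : D) (w : E) :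
    fderiv ℝ (fun x => (fderiv ℝ g (c x)).comp A) a v w
      = fderiv ℝ (fderiv ℝ g) (c a) (c' v) (A w) := by
  have hg' : DifferentiableAt ℝ (fderiv ℝ g) (c a) :=
    (hg.fderiv_right (m := 1) (by norm_num)).differentiableAt one_ne_zero
  have h := (HasFDerivAt.comp (f := c) a hg'.hasFDerivAt hc).clm_comp (hasFDerivAt_const A a)
  simp [HasFDerivAt.fderiv (f := fun x => (fderiv ℝ g (c x)).comp A) h]

lemma fderiv_fderiv_comm {f : D → E → F} {a : D} {b : E}
    (hf : ContDiffAt ℝ 2 (Function.uncurry f) (a, b)) (v : D) (w : E) :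
    fderiv ℝ (fun x => fderiv ℝ (f x) b) a v w
      = fderiv ℝ (fun y => fderiv ℝ (fun x => f x y) a) b w v := by
  have hd : ∀ᶠ p in 𝓝 (a, b), DifferentiableAt ℝ (Function.uncurry f) p :=
    (hf.eventually (by simp)).mono fun p hp => hp.differentiableAt two_ne_zero
  have hl := hasFDerivAt_prodMk_left (𝕜 := ℝ) a b
  have hr := hasFDerivAt_prodMk_right (𝕜 := ℝ) a b
  have hsnd : (fun x => fderiv ℝ (f x) b) =ᶠ[𝓝 a] fun x =>
      (fderiv ℝ (Function.uncurry f) (x, b)).comp (.inr ℝ D E) := by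
    filter_upwards [hl.continuousAt.eventually hd] with x hx
    exact (hx.hasFDerivAt.comp b (hasFDerivAt_prodMk_right x b)).fderiv
  have hfst : (fun y => fderiv ℝ (fun x => f x y) a) =ᶠ[𝓝 b] fun y =>
      (fderiv ℝ (Function.uncurry f) (a, y)).comp (.inl ℝ D E) := by
    filter_upwards [hr.continuousAt.eventually hd] with y hy
    exact (HasFDerivAt.comp (f := fun x => (x, y)) a hy.hasFDerivAt
      (hasFDerivAt_prodMk_left a y)).fderiv
  rw [hsnd.fderiv_eq, hfst.fderiv_eq, fderiv_fderiv_comp_apply hl hf,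
    fderiv_fderiv_comp_apply hr hf]
  exact (hf.isSymmSndFDerivAt (by simp)).eq _ _

end AlternatingCalculus

section Forms

variable {E : Type*} [NormedAddCommGroup E] [NormedSpace ℝ E]
  {X : Type*} [TopologicalSpace X] {I : ModelWithCorners ℝ E X}
  {M : Type*} [TopologicalSpace M] [ChartedSpace X M]
  {F : Type*} [NormedAddCommGroup F] [NormedSpace ℝ F]
  {Y : Type*} [TopologicalSpace Y] {J : ModelWithCorners ℝ F Y}
  {N : Type*} [TopologicalSpace N] [ChartedSpace Y N]
  {k : ℕ}

section Pointwise

variable {G : Type*} [NormedAddCommGroup G] [NormedSpace ℝ G]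
  {Z : Type*} [TopologicalSpace Z] {K : ModelWithCorners ℝ G Z}
  {Q : Type*} [TopologicalSpace Q] [ChartedSpace Z Q]

lemma pullback_apply_of_hasMFDerivAt {f : M → N} {Ω : DiffForm J N k} {x : M} {y : N}
    {A : E →L[ℝ] F} (hxy : f x = y) (hf : HasMFDerivAt I J f x A) (v : Fin k → E) :
    pullback I J f Ω x v = Ω y (fun i => A (v i)) := by
  subst hxy
  unfold pullback
  rw [hf.mfderiv]
  rfl

lemma pullback_comp {g : N → Q} {f : M → N} {Ω : DiffForm K Q k} {x : M}
    (hg : MDifferentiableAt J K g (f x)) (hf : MDifferentiableAt I J f x) :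
    pullback I K (g ∘ f) Ω x = pullback I J f (pullback J K g Ω) x := by
  unfold pullback
  rw [mfderiv_comp x hg hf]
  rfl

lemma pullback_congr {f g : M → N} {Ω : DiffForm J N k} {x : M} (h : f =ᶠ[𝓝 x] g) :
    pullback I J f Ω x = pullback I J g Ω x := by
  have hΩ : ∀ p q : N, p = q →
      (show F [⋀^Fin k]→L[ℝ] ℝ from Ω p) = (show F [⋀^Fin k]→L[ℝ] ℝ from Ω q) := by
    rintro p _ rfl
    rfl
  have hd : (mfderiv I J f x : E →L[ℝ] F) = mfderiv I J g x := h.mfderiv_eq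
  exact congrArg₂ (fun (β : F [⋀^Fin k]→L[ℝ] ℝ) (A : E →L[ℝ] F) => β.compContinuousLinearMap A)
    (hΩ _ _ h.eq_of_nhds) hd

lemma pullback_id {Ω : DiffForm I M k} {x : M} : pullback I I id Ω x = Ω x := by
  unfold pullback
  rw [mfderiv_id]
  rfl

variable (I) in
/-- Smoothness of a form at a point, in the chart around this point. -/
def SmoothFormAt (Ω : DiffForm I M k) (x : M) : Prop :=
  ContDiffAt ℝ ∞ (chartRep I Ω x) (extChartAt I x x)

lemma SmoothFormAt.sub {Ω Ω' : DiffForm I M k} {x : M} (h : SmoothFormAt I Ω x)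
    (h' : SmoothFormAt I Ω' x) : SmoothFormAt I (fun y => Ω y - Ω' y) x :=
  ContDiffAt.sub h h'

lemma SmoothFormAt.neg {Ω : DiffForm I M k} {x : M} (h : SmoothFormAt I Ω x) :
    SmoothFormAt I (fun y => -Ω y) x :=
  ContDiffAt.neg h

lemma SmoothFormAt.differentiableAt {Ω : DiffForm I M k} {x : M} (h : SmoothFormAt I Ω x) :
    DifferentiableAt ℝ (chartRep I Ω x) (extChartAt I x x) :=
  ContDiffAt.differentiableAt h (by simp)

lemma chartRep_modelSpace (Ω : DiffForm 𝓘(ℝ, E) E k) (x : E) : chartRep 𝓘(ℝ, E) Ω x = Ω :=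
  funext fun _ => pullback_id

lemma smoothFormAt_modelSpace {Ω : DiffForm 𝓘(ℝ, E) E k} {x : E} :
    SmoothFormAt 𝓘(ℝ, E) Ω x ↔ ContDiffAt ℝ ∞ (show E → E [⋀^Fin k]→L[ℝ] ℝ from Ω) x := by
  unfold SmoothFormAt
  rw [chartRep_modelSpace]
  rfl

lemma extD_neg {Ω : DiffForm I M k} {x : M} : extD I (fun y => -Ω y) x = -extD I Ω x := by
  have h : extDeriv (fun a => -chartRep I Ω x a) (extChartAt I x x)
      = -extDeriv (chartRep I Ω x) (extChartAt I x x) := by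
    have hsmul := extDeriv_fun_smul (-1 : ℝ) (chartRep I Ω x) (x := extChartAt I x x)
    simp only [neg_smul, one_smul] at hsmul
    exact hsmul
  exact congrArg (fun β : E [⋀^Fin (k + 1)]→L[ℝ] ℝ => β.compContinuousLinearMap
    (mfderiv I 𝓘(ℝ, E) (extChartAt I x) x)) h

lemma extD_add {Ω Ω' : DiffForm I M k} {x : M} (hΩ : SmoothFormAt I Ω x)
    (hΩ' : SmoothFormAt I Ω' x) :
    extD I (fun y => Ω y + Ω' y) x = extD I Ω x + extD I Ω' x :=
  congrArg (fun β : E [⋀^Fin (k + 1)]→L[ℝ] ℝ => β.compContinuousLinearMap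
    (mfderiv I 𝓘(ℝ, E) (extChartAt I x) x))
    (extDeriv_fun_add hΩ.differentiableAt hΩ'.differentiableAt)

lemma extD_sub {Ω Ω' : DiffForm I M k} {x : M} (hΩ : SmoothFormAt I Ω x)
    (hΩ' : SmoothFormAt I Ω' x) :
    extD I (fun y => Ω y - Ω' y) x = extD I Ω x - extD I Ω' x := by
  simp only [sub_eq_add_neg]
  rw [extD_add hΩ hΩ'.neg, extD_neg]

end Pointwise

section Charts

lemma extD_eq_extDeriv [IsManifold I ∞ M] (Ω : DiffForm I M k) (x : M) :
    extD I Ω x = extDeriv (chartRep I Ω x) (extChartAt I x x) := by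
  unfold extD
  rw [mfderiv_extChartAt_self]
  rfl

lemma extD_modelSpace (Ω : DiffForm 𝓘(ℝ, E) E k) (x : E) :
    extD 𝓘(ℝ, E) Ω x = extDeriv (show E → E [⋀^Fin k]→L[ℝ] ℝ from Ω) x := by
  rw [extD_eq_extDeriv, chartRep_modelSpace]
  rfl

variable [I.Boundaryless]

lemma contMDiffAt_extChartAt_symm [IsManifold I ∞ M] {x₀ : M} {a : E}
    (ha : a ∈ (extChartAt I x₀).target) :
    ContMDiffAt 𝓘(ℝ, E) I ∞ (extChartAt I x₀).symm a :=
  (contMDiffOn_extChartAt_symm x₀).contMDiffAt (extChartAt_target_mem_nhds' ha)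

lemma mdifferentiableAt_extChartAt_symm [IsManifold I ∞ M] {x₀ : M} {a : E}
    (ha : a ∈ (extChartAt I x₀).target) :
    MDifferentiableAt 𝓘(ℝ, E) I (extChartAt I x₀).symm a :=
  (contMDiffAt_extChartAt_symm ha).mdifferentiableAt (by simp)

lemma contDiffAt_writtenInExtChartAt {f : M → N} {x : M} (hf : ContMDiffAt I J ∞ f x) :
    ContDiffAt ℝ ∞ (writtenInExtChartAt I J x f) (extChartAt I x x) := by
  have h := (contMDiffAt_iff.1 hf).2
  rw [I.range_eq_univ] at h
  exact contDiffWithinAt_univ.1 h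

lemma mfderiv_eq_fderiv_writtenInExtChartAt {f : M → N} {x : M} (hf : MDifferentiableAt I J f x) :
    mfderiv I J f x = fderiv ℝ (writtenInExtChartAt I J x f) (extChartAt I x x) := by
  rw [hf.mfderiv, I.range_eq_univ, fderivWithin_univ]

variable [J.Boundaryless] [IsManifold I ∞ M] [IsManifold J ∞ N]

lemma chartRep_pullback_eventuallyEq {f : M → N} {x : M} (hf : ContMDiffAt I J ∞ f x)
    (Ω : DiffForm J N k) :
    chartRep I (pullback I J f Ω) x =ᶠ[𝓝 (extChartAt I x x)] fun a =>
      (chartRep J Ω (f x) (writtenInExtChartAt I J x f a)).compContinuousLinearMap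
        (fderiv ℝ (writtenInExtChartAt I J x f) a) := by
  have hsymm : Tendsto (extChartAt I x).symm (𝓝 (extChartAt I x x)) (𝓝 x) := by
    simpa only [extChartAt_to_inv] using (continuousAt_extChartAt_symm x).tendsto
  have hdiff : ∀ᶠ y in 𝓝 x, MDifferentiableAt I J f y :=
    (contMDiffAt_iff_contMDiffAt_nhds (n := 1) (by simp)).1 (hf.of_le (by exact_mod_cast le_top))
      |>.mono fun y hy => hy.mdifferentiableAt one_ne_zero
  have hsrc := hsymm.eventually (hf.continuousAt.eventually
    (extChartAt_source_mem_nhds (I := J) (f x)))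
  filter_upwards [hsymm.eventually hdiff, hsrc, hsrc.eventually_nhds, extChartAt_target_mem_nhds x]
    with a hfa ha ha' hat
  have hφ := mdifferentiableAt_extChartAt_symm hat
  have hψ : MDifferentiableAt J 𝓘(ℝ, F) (extChartAt J (f x)) (f ((extChartAt I x).symm a)) :=
    mdifferentiableAt_extChartAt (by rwa [← extChartAt_source (I := J)])
  have hψ' : MDifferentiableAt 𝓘(ℝ, F) J (extChartAt J (f x)).symm
      (writtenInExtChartAt I J x f a) :=
    mdifferentiableAt_extChartAt_symm ((extChartAt J (f x)).map_source ha)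
  have hw : MDifferentiableAt 𝓘(ℝ, E) 𝓘(ℝ, F) (writtenInExtChartAt I J x f) a :=
    MDifferentiableAt.comp (I' := J) a hψ (MDifferentiableAt.comp (I' := I) a hfa hφ)
  have hfactor : f ∘ (extChartAt I x).symm =ᶠ[𝓝 a]
      (extChartAt J (f x)).symm ∘ writtenInExtChartAt I J x f :=
    ha'.mono fun b hb => ((extChartAt J (f x)).left_inv hb).symm
  refine (pullback_comp hfa hφ).symm.trans ((pullback_congr hfactor).trans ?_)
  refine (pullback_comp hψ' hw).trans ?_
  unfold BodyReduction.pullback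
  rw [mfderiv_eq_fderiv]
  rfl

lemma SmoothFormAt.pullback {f : M → N} {x : M} (hf : ContMDiffAt I J ∞ f x)
    {Ω : DiffForm J N k} (hΩ : SmoothFormAt J Ω (f x)) :
    SmoothFormAt I (pullback I J f Ω) x := by
  have hw := contDiffAt_writtenInExtChartAt hf
  have hx : writtenInExtChartAt I J x f (extChartAt I x x) = extChartAt J (f x) (f x) := by
    simp [writtenInExtChartAt]
  exact (contDiffAt_compContinuousLinearMap (ContDiffAt.comp _ (hx ▸ hΩ) hw)
    (hw.fderiv_right (m := ∞) le_rfl)).congr_of_eventuallyEq (chartRep_pullback_eventuallyEq hf Ω)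

lemma minSmoothness_two_le : minSmoothness ℝ 2 ≤ (∞ : WithTop ℕ∞) := by
  rw [minSmoothness_of_isRCLikeNormedField]
  exact WithTop.coe_le_coe.2 le_top

lemma extD_pullback {f : M → N} {x : M} (hf : ContMDiffAt I J ∞ f x) {Ω : DiffForm J N k}
    (hΩ : SmoothFormAt J Ω (f x)) :
    extD I (pullback I J f Ω) x = pullback I J f (extD J Ω) x := by
  have hw := contDiffAt_writtenInExtChartAt hf
  have hx : writtenInExtChartAt I J x f (extChartAt I x x) = extChartAt J (f x) (f x) := by
    simp [writtenInExtChartAt]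
  rw [extD_eq_extDeriv, (chartRep_pullback_eventuallyEq hf Ω).extDeriv_eq,
    extDeriv_pullback (hx ▸ hΩ.differentiableAt) hw minSmoothness_two_le, hx]
  unfold BodyReduction.pullback
  rw [extD_eq_extDeriv, mfderiv_eq_fderiv_writtenInExtChartAt (hf.mdifferentiableAt (by simp))]
  rfl

lemma isSmoothForm_iff {Ω : DiffForm I M k} : IsSmoothForm I Ω ↔ ∀ x, SmoothFormAt I Ω x := by
  refine ⟨fun h x => (h x).contDiffAt (extChartAt_target_mem_nhds x), fun h x₀ a ha => ?_⟩
  have hpull := (h ((extChartAt I x₀).symm a)).pullback (contMDiffAt_extChartAt_symm ha)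
  exact (smoothFormAt_modelSpace.1 hpull).contDiffWithinAt

lemma chartRep_extD_eventuallyEq {Ω : DiffForm I M k} (hΩ : ∀ x, SmoothFormAt I Ω x) (x : M) :
    chartRep I (extD I Ω) x =ᶠ[𝓝 (extChartAt I x x)] extDeriv (chartRep I Ω x) := by
  filter_upwards [extChartAt_target_mem_nhds x] with a ha
  have h := extD_pullback (contMDiffAt_extChartAt_symm ha) (hΩ _)
  rw [extD_modelSpace] at h
  exact h.symm

lemma smoothFormAt_extD {Ω : DiffForm I M k} (hΩ : ∀ x, SmoothFormAt I Ω x) (x : M) :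
    SmoothFormAt I (extD I Ω) x :=
  ContDiffAt.congr_of_eventuallyEq (contDiffAt_extDeriv (hΩ x)) (chartRep_extD_eventuallyEq hΩ x)

lemma extD_extD {Ω : DiffForm I M k} (hΩ : ∀ x, SmoothFormAt I Ω x) (x : M) :
    extD I (extD I Ω) x = 0 := by
  rw [extD_eq_extDeriv, (chartRep_extD_eventuallyEq hΩ x).extDeriv_eq]
  exact extDeriv_extDeriv_apply (hΩ x) minSmoothness_two_le

end Charts

end Forms

section ChartDerivatives

variable {E : Type*} [NormedAddCommGroup E] [NormedSpace ℝ E]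
  {X : Type*} [TopologicalSpace X] {I : ModelWithCorners ℝ E X}
  {M : Type*} [TopologicalSpace M] [ChartedSpace X M] [IsManifold I ∞ M]
  {F : Type*} [NormedAddCommGroup F] [NormedSpace ℝ F]
  {Y : Type*} [TopologicalSpace Y] {J : ModelWithCorners ℝ F Y}
  {N : Type*} [TopologicalSpace N] [ChartedSpace Y N] [IsManifold J ∞ N]

lemma hasMFDerivAt_extChartAt_self (x : M) :
    HasMFDerivAt I 𝓘(ℝ, E) (extChartAt I x) x (ContinuousLinearMap.id ℝ E) := by
  have h := (mdifferentiableAt_extChartAt (I := I) (mem_chart_source X x)).hasMFDerivAt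
  rwa [mfderiv_extChartAt_self] at h

variable [I.Boundaryless]

lemma mfderiv_extChartAt_symm_apply_mfderiv {x₀ x : M} (hx : x ∈ (extChartAt I x₀).source)
    (v : TangentSpace I x) :
    (mfderiv 𝓘(ℝ, E) I (extChartAt I x₀).symm (extChartAt I x₀ x) : E →L[ℝ] E)
      ((mfderiv I 𝓘(ℝ, E) (extChartAt I x₀) x : E →L[ℝ] E) v) = v := by
  have h := mfderivWithin_extChartAt_symm_comp_mfderiv_extChartAt' hx
  rw [I.range_eq_univ, mfderivWithin_univ] at h
  exact DFunLike.congr_fun h v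

lemma hasMFDerivAt_extChartAt_symm_self (x : M) :
    HasMFDerivAt 𝓘(ℝ, E) I (extChartAt I x).symm (extChartAt I x x)
      (ContinuousLinearMap.id ℝ E) := by
  have h := (mdifferentiableAt_extChartAt_symm (I := I) (mem_extChartAt_target x)).hasMFDerivAt
  have hid := mfderivWithin_range_extChartAt_symm (I := I) (x := x)
  rw [I.range_eq_univ, mfderivWithin_univ] at hid
  exact hid ▸ h

lemma symmL_trivializationAt_eq {x₀ x : M} (hx : x ∈ (extChartAt I x₀).source) :
    ((trivializationAt E (TangentSpace I) x₀).symmL ℝ x : E →L[ℝ] E)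
      = mfderiv 𝓘(ℝ, E) I (extChartAt I x₀).symm (extChartAt I x₀ x) := by
  have h := TangentBundle.symmL_trivializationAt (I := I) (x₀ := x₀) (x := x)
    (by rwa [← extChartAt_source (I := I)])
  rwa [I.range_eq_univ, mfderivWithin_univ] at h

lemma hasFDerivAt_comp_extChartAt_symm {f : M → F} {x : M} {A : E →L[ℝ] F}
    (hf : HasMFDerivAt I 𝓘(ℝ, F) f x A) :
    HasFDerivAt (f ∘ (extChartAt I x).symm) A (extChartAt I x x) := by
  have hf' : HasMFDerivAt I 𝓘(ℝ, F) f ((extChartAt I x).symm (extChartAt I x x)) A := by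
    rwa [extChartAt_to_inv]
  exact (HasMFDerivAt.comp _ hf' (hasMFDerivAt_extChartAt_symm_self x)).hasFDerivAt

lemma hasFDerivAt_extChartAt_comp_symm {f : M → N} {x : M} {y₀ y : N} {A : E →L[ℝ] F}
    (hxy : f x = y) (hf : HasMFDerivAt I J f x A) (hy : y ∈ (extChartAt J y₀).source) :
    HasFDerivAt ((extChartAt J y₀ ∘ f) ∘ (extChartAt I x).symm)
      ((mfderiv J 𝓘(ℝ, F) (extChartAt J y₀) y : F →L[ℝ] F).comp A) (extChartAt I x x) := by
  subst hxy
  rw [extChartAt_source] at hy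
  exact hasFDerivAt_comp_extChartAt_symm
    (HasMFDerivAt.comp x (mdifferentiableAt_extChartAt hy).hasMFDerivAt hf)

lemma mfderiv_extChartAt_prod_symm_fst [J.Boundaryless] (p : M × N) {a : E × F}
    (ha : a ∈ (extChartAt (I.prod J) p).target) (v : E × F) :
    ((mfderiv 𝓘(ℝ, E × F) (I.prod J) (extChartAt (I.prod J) p).symm a : E × F →L[ℝ] E × F) v).1
      = (mfderiv 𝓘(ℝ, E) I (extChartAt I p.1).symm a.1 : E →L[ℝ] E) v.1 := by
  have ha₁ : a.1 ∈ (extChartAt I p.1).target := by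
    rw [extChartAt_prod] at ha
    exact ha.1
  have hprod : HasMFDerivAt 𝓘(ℝ, E × F) I
      (fun b => ((extChartAt (I.prod J) p).symm b).1) a
      ((ContinuousLinearMap.fst ℝ E F).comp
        (mfderiv 𝓘(ℝ, E × F) (I.prod J) (extChartAt (I.prod J) p).symm a)) :=
    HasMFDerivAt.comp a (hasMFDerivAt_fst _) (mdifferentiableAt_extChartAt_symm ha).hasMFDerivAt
  have hfst : HasMFDerivAt 𝓘(ℝ, E × F) I
      (fun b : E × F => (extChartAt I p.1).symm b.1) a
      ((mfderiv 𝓘(ℝ, E) I (extChartAt I p.1).symm a.1 : E →L[ℝ] E).comp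
        (ContinuousLinearMap.fst ℝ E F)) :=
    HasMFDerivAt.comp a (I' := 𝓘(ℝ, E)) (mdifferentiableAt_extChartAt_symm ha₁).hasMFDerivAt
      hasFDerivAt_fst.hasMFDerivAt
  have hsymm : (fun b => ((extChartAt (I.prod J) p).symm b).1)
      = fun b : E × F => (extChartAt I p.1).symm b.1 := by
    rw [extChartAt_prod]
    rfl
  exact DFunLike.congr_fun (hasMFDerivAt_unique hprod (hsymm ▸ hfst)) v

end ChartDerivatives

section LieGroup

variable {E : Type*} [NormedAddCommGroup E] [NormedSpace ℝ E]
  {X : Type*} [TopologicalSpace X] {I : ModelWithCorners ℝ E X}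
  {H : Type*} [TopologicalSpace H] [ChartedSpace X H] [Group H]

variable (I) in
/-- The tangent map `T_1 R_g : 𝔥 → T_g H` of right translation. -/
def rightTangent (g : H) : GroupLieAlgebra I H →L[ℝ] TangentSpace I g :=
  (mfderiv I I (fun h : H => h * g) (1 : H) : E →L[ℝ] E)

lemma leftTangent_one : (leftTangent I (1 : H) : E →L[ℝ] E) = ContinuousLinearMap.id ℝ E := by
  have h : (fun h : H => 1 * h) = id := funext one_mul
  unfold leftTangent
  rw [h]
  exact mfderiv_id

lemma leftTangentInv_one :
    (leftTangentInv I (1 : H) : E →L[ℝ] E) = ContinuousLinearMap.id ℝ E := by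
  have h : (fun h : H => (1 : H)⁻¹ * h) = id := funext fun h => by rw [inv_one, one_mul, id]
  unfold leftTangentInv
  rw [h]
  exact mfderiv_id

lemma rightTangent_one : (rightTangent I (1 : H) : E →L[ℝ] E) = ContinuousLinearMap.id ℝ E := by
  have h : (fun h : H => h * 1) = id := funext mul_one
  unfold rightTangent
  rw [h]
  exact mfderiv_id

variable [LieGroup I ∞ H]

lemma hasMFDerivAt_mul_left_one (g : H) :
    HasMFDerivAt I I (fun h : H => g * h) (1 : H) (leftTangent I g : E →L[ℝ] E) :=
  ((contMDiff_mul_left (I := I) (n := ∞)).contMDiffAt.mdifferentiableAt (by simp)).hasMFDerivAt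

lemma hasMFDerivAt_mul_right_one (g : H) :
    HasMFDerivAt I I (fun h : H => h * g) (1 : H) (rightTangent I g : E →L[ℝ] E) :=
  ((contMDiff_mul_right (I := I) (n := ∞)).contMDiffAt.mdifferentiableAt (by simp)).hasMFDerivAt

lemma hasMFDerivAt_mul_left_inv (g : H) :
    HasMFDerivAt I I (fun h : H => g⁻¹ * h) g (leftTangentInv I g : E →L[ℝ] E) :=
  ((contMDiff_mul_left (I := I) (n := ∞)).contMDiffAt.mdifferentiableAt (by simp)).hasMFDerivAt

lemma Ad_inv_eq (g : H) : Ad I g⁻¹ = (leftTangentInv I g).comp (rightTangent I g) := by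
  have hleft : HasMFDerivAt I I (fun h : H => g⁻¹ * h) (1 * g)
      (leftTangentInv I g : E →L[ℝ] E) := by
    rw [one_mul]
    exact hasMFDerivAt_mul_left_inv g
  have hconj : (fun h : H => g⁻¹ * h * g⁻¹⁻¹) = (fun h : H => g⁻¹ * h) ∘ fun h : H => h * g := by
    ext h
    simp [mul_assoc]
  unfold Ad
  rw [hconj]
  exact (HasMFDerivAt.comp (1 : H) hleft (hasMFDerivAt_mul_right_one g)).mfderiv

variable (I) in
/-- The left Maurer-Cartan form in the trivialization of the tangent bundle around `g₀`. -/
def maurerCartanCoord (g₀ g : H) : E →L[ℝ] E :=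
  (leftTangentInv I g : E →L[ℝ] E).comp
    ((trivializationAt E (TangentSpace I) g₀).symmL ℝ g : E →L[ℝ] E)

lemma contMDiffAt_maurerCartanCoord (g₀ : H) :
    ContMDiffAt I 𝓘(ℝ, E →L[ℝ] E) ∞ (maurerCartanCoord I g₀) g₀ := by
  have := LieGroup.toContMDiffMul (I := I) (n := ∞) (G := H)
  have hdiv : ContMDiffAt (I.prod I) I ∞ (Function.uncurry fun g h : H => g⁻¹ * h) (g₀, g₀) :=
    (((contMDiff_inv I ∞).comp contMDiff_fst).mul contMDiff_snd).contMDiffAt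
  have hmfderiv := ContMDiffAt.mfderiv (m := ∞) (fun g h : H => g⁻¹ * h) (fun g => g) hdiv
    contMDiffAt_id le_rfl
  refine hmfderiv.congr_of_eventuallyEq (Eventually.of_forall fun g => ?_)
  have htriv : ∀ k₁ k₂ : H, k₁ = 1 → k₂ = 1 →
      ((trivializationAt E (TangentSpace I) k₁).continuousLinearMapAt ℝ k₂ : E →L[ℝ] E)
        = ContinuousLinearMap.id ℝ E := by
    rintro _ _ rfl rfl
    rw [TangentBundle.continuousLinearMapAt_trivializationAt (mem_chart_source X (1 : H)),
      mfderiv_extChartAt_self]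
    rfl
  ext v
  exact (DFunLike.congr_fun
    (htriv (g₀⁻¹ * g₀) (g⁻¹ * g) (inv_mul_cancel _) (inv_mul_cancel _)) _).symm

end LieGroup

section LieGroupChart

variable {E : Type*} [NormedAddCommGroup E] [NormedSpace ℝ E]
  {X : Type*} [TopologicalSpace X] (I : ModelWithCorners ℝ E X)
  (H : Type*) [TopologicalSpace H] [ChartedSpace X H] [Group H]

/-- The coordinates of the identity. -/
def chartOne : E := extChartAt I (1 : H) (1 : H)

/-- The multiplication read in the chart around the identity. -/
def mulChart (a b : E) : E :=
  extChartAt I (1 : H) ((extChartAt I (1 : H)).symm a * (extChartAt I (1 : H)).symm b)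

/-- The tangent maps at `1` of left translations, in the chart around the identity. -/
def leftTangentChart (a : E) : E →L[ℝ] E := fderiv ℝ (mulChart I H a) (chartOne I H)

/-- The tangent maps at `1` of right translations, in the chart around the identity. -/
def rightTangentChart (a : E) : E →L[ℝ] E := fderiv ℝ (fun b => mulChart I H b a) (chartOne I H)

/-- The left Maurer-Cartan form in the chart around the identity. -/
def maurerCartanChart (a : E) : E →L[ℝ] E :=
  (leftTangentInv I ((extChartAt I (1 : H)).symm a) : E →L[ℝ] E).comp
    (mfderiv 𝓘(ℝ, E) I (extChartAt I (1 : H)).symm a : E →L[ℝ] E)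

variable {I H}

lemma extChartAt_symm_chartOne : (extChartAt I (1 : H)).symm (chartOne I H) = 1 :=
  extChartAt_to_inv (1 : H)

lemma chartOne_mem_target : chartOne I H ∈ (extChartAt I (1 : H)).target :=
  mem_extChartAt_target (1 : H)

variable [I.Boundaryless]

lemma eventually_mem_target_chartOne :
    ∀ᶠ a in 𝓝 (chartOne I H), a ∈ (extChartAt I (1 : H)).target :=
  extChartAt_target_mem_nhds (1 : H)

variable [LieGroup I ∞ H]

lemma contDiffAt_mulChart :
    ContDiffAt ℝ ∞ (Function.uncurry (mulChart I H)) (chartOne I H, chartOne I H) := by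
  have := LieGroup.toContMDiffMul (I := I) (n := ∞) (G := H)
  have hsymm : ContMDiffAt 𝓘(ℝ, E) I ∞ (extChartAt I (1 : H)).symm (chartOne I H) :=
    contMDiffAt_extChartAt_symm chartOne_mem_target
  have hfst : ContMDiffAt 𝓘(ℝ, E × E) I ∞ (fun a : E × E => (extChartAt I (1 : H)).symm a.1)
      (chartOne I H, chartOne I H) :=
    ContMDiffAt.comp _ (I' := 𝓘(ℝ, E)) hsymm contDiff_fst.contMDiff.contMDiffAt
  have hsnd : ContMDiffAt 𝓘(ℝ, E × E) I ∞ (fun a : E × E => (extChartAt I (1 : H)).symm a.2)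
      (chartOne I H, chartOne I H) :=
    ContMDiffAt.comp _ (I' := 𝓘(ℝ, E)) hsymm contDiff_snd.contMDiff.contMDiffAt
  refine (contMDiffAt_extChartAt.comp_of_eq (hfst.mul hsnd) ?_).contDiffAt
  change (extChartAt I (1 : H)).symm (chartOne I H) * (extChartAt I (1 : H)).symm (chartOne I H) = 1
  rw [extChartAt_symm_chartOne, mul_one]

lemma contDiffAt_leftTangentChart : ContDiffAt ℝ ∞ (leftTangentChart I H) (chartOne I H) :=
  ContDiffAt.fderiv contDiffAt_mulChart contDiffAt_const le_rfl

lemma contDiffAt_rightTangentChart : ContDiffAt ℝ ∞ (rightTangentChart I H) (chartOne I H) :=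
  ContDiffAt.fderiv (f := fun a b => mulChart I H b a)
    (ContDiffAt.comp (g := Function.uncurry (mulChart I H)) (f := Prod.swap)
      (chartOne I H, chartOne I H) contDiffAt_mulChart (contDiffAt_snd.prodMk contDiffAt_fst))
    contDiffAt_const le_rfl

lemma fderiv_rightTangentChart_apply (v w : E) :
    fderiv ℝ (rightTangentChart I H) (chartOne I H) v w
      = fderiv ℝ (leftTangentChart I H) (chartOne I H) w v :=
  (fderiv_fderiv_comm (contDiffAt_mulChart.of_le (WithTop.coe_le_coe.2 le_top)) w v).symm

lemma leftTangentChart_eq {a : E} (ha : a ∈ (extChartAt I (1 : H)).target) :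
    leftTangentChart I H a
      = (mfderiv I 𝓘(ℝ, E) (extChartAt I (1 : H)) ((extChartAt I (1 : H)).symm a) :
          E →L[ℝ] E).comp (leftTangent I ((extChartAt I (1 : H)).symm a) : E →L[ℝ] E) := by
  let A : E →L[ℝ] E := leftTangent I ((extChartAt I (1 : H)).symm a)
  let B : E →L[ℝ] E :=
    mfderiv I 𝓘(ℝ, E) (extChartAt I (1 : H)) ((extChartAt I (1 : H)).symm a)
  have h : HasFDerivAt (mulChart I H a) (B.comp A) (chartOne I H) :=
    hasFDerivAt_extChartAt_comp_symm (f := fun h : H => (extChartAt I (1 : H)).symm a * h)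
      (mul_one _) (hasMFDerivAt_mul_left_one _) ((extChartAt I (1 : H)).map_target ha)
  exact h.fderiv

lemma rightTangentChart_eq {a : E} (ha : a ∈ (extChartAt I (1 : H)).target) :
    rightTangentChart I H a
      = (mfderiv I 𝓘(ℝ, E) (extChartAt I (1 : H)) ((extChartAt I (1 : H)).symm a) :
          E →L[ℝ] E).comp (rightTangent I ((extChartAt I (1 : H)).symm a) : E →L[ℝ] E) := by
  let A : E →L[ℝ] E := rightTangent I ((extChartAt I (1 : H)).symm a)
  let B : E →L[ℝ] E :=
    mfderiv I 𝓘(ℝ, E) (extChartAt I (1 : H)) ((extChartAt I (1 : H)).symm a)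
  have h : HasFDerivAt (fun b => mulChart I H b a) (B.comp A) (chartOne I H) :=
    hasFDerivAt_extChartAt_comp_symm (f := fun h : H => h * (extChartAt I (1 : H)).symm a)
      (one_mul _) (hasMFDerivAt_mul_right_one _) ((extChartAt I (1 : H)).map_target ha)
  exact h.fderiv

lemma leftTangentChart_one :
    leftTangentChart I H (chartOne I H) = ContinuousLinearMap.id ℝ E := by
  rw [leftTangentChart_eq chartOne_mem_target, extChartAt_symm_chartOne, leftTangent_one,
    mfderiv_extChartAt_self]
  rfl

lemma rightTangentChart_one :
    rightTangentChart I H (chartOne I H) = ContinuousLinearMap.id ℝ E := by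
  rw [rightTangentChart_eq chartOne_mem_target, extChartAt_symm_chartOne, rightTangent_one,
    mfderiv_extChartAt_self]
  rfl

lemma maurerCartanChart_one :
    maurerCartanChart I H (chartOne I H) = ContinuousLinearMap.id ℝ E := by
  unfold maurerCartanChart
  rw [extChartAt_symm_chartOne, leftTangentInv_one]
  exact (hasMFDerivAt_extChartAt_symm_self (1 : H)).mfderiv

lemma maurerCartanChart_mfderiv_extChartAt {a : E} (ha : a ∈ (extChartAt I (1 : H)).target)
    (v : TangentSpace I ((extChartAt I (1 : H)).symm a)) :
    maurerCartanChart I H a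
        ((mfderiv I 𝓘(ℝ, E) (extChartAt I (1 : H)) ((extChartAt I (1 : H)).symm a) : E →L[ℝ] E) v)
      = leftTangentInv I ((extChartAt I (1 : H)).symm a) v := by
  have h := mfderiv_extChartAt_symm_apply_mfderiv ((extChartAt I (1 : H)).map_target ha) v
  rw [(extChartAt I (1 : H)).right_inv ha] at h
  exact congrArg (leftTangentInv I ((extChartAt I (1 : H)).symm a) : E →L[ℝ] E) h

lemma maurerCartanChart_comp_leftTangentChart {a : E} (ha : a ∈ (extChartAt I (1 : H)).target) :
    (maurerCartanChart I H a).comp (leftTangentChart I H a) = ContinuousLinearMap.id ℝ E := by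
  rw [leftTangentChart_eq ha]
  ext v
  exact (maurerCartanChart_mfderiv_extChartAt ha _).trans (leftTangentInv_comp_leftTangent _ v)

lemma maurerCartanChart_comp_rightTangentChart {a : E}
    (ha : a ∈ (extChartAt I (1 : H)).target) :
    (maurerCartanChart I H a).comp (rightTangentChart I H a)
      = (Ad I ((extChartAt I (1 : H)).symm a)⁻¹ : E →L[ℝ] E) := by
  rw [Ad_inv_eq, rightTangentChart_eq ha]
  ext v
  exact maurerCartanChart_mfderiv_extChartAt ha _

lemma contDiffAt_maurerCartanChart :
    ContDiffAt ℝ ∞ (maurerCartanChart I H) (chartOne I H) := by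
  have hcoord : ContMDiffAt I 𝓘(ℝ, E →L[ℝ] E) ∞ (maurerCartanCoord I (1 : H))
      ((extChartAt I (1 : H)).symm (chartOne I H)) := by
    rw [extChartAt_symm_chartOne]
    exact contMDiffAt_maurerCartanCoord 1
  refine (ContMDiffAt.comp _ hcoord
    (contMDiffAt_extChartAt_symm chartOne_mem_target)).contDiffAt.congr_of_eventuallyEq ?_
  filter_upwards [eventually_mem_target_chartOne (I := I) (H := H)] with a ha
  have hsymmL := symmL_trivializationAt_eq (I := I) ((extChartAt I (1 : H)).map_target ha)
  rw [(extChartAt I (1 : H)).right_inv ha] at hsymmL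
  exact congrArg (leftTangentInv I ((extChartAt I (1 : H)).symm a) : E →L[ℝ] E).comp hsymmL.symm

lemma fderiv_maurerCartanChart_apply (v w : E) :
    fderiv ℝ (maurerCartanChart I H) (chartOne I H) v w
      = -fderiv ℝ (leftTangentChart I H) (chartOne I H) v w := by
  have hmc := (contDiffAt_maurerCartanChart (I := I) (H := H)).differentiableAt (by simp)
  have hleft := (contDiffAt_leftTangentChart (I := I) (H := H)).differentiableAt (by simp)
  have hid : (fun a => (maurerCartanChart I H a).comp (leftTangentChart I H a))
      =ᶠ[𝓝 (chartOne I H)] fun _ => ContinuousLinearMap.id ℝ E :=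
    eventually_mem_target_chartOne.mono fun a ha => maurerCartanChart_comp_leftTangentChart ha
  have hzero := (hmc.hasFDerivAt.clm_comp hleft.hasFDerivAt).unique
    ((hasFDerivAt_const _ _).congr_of_eventuallyEq hid)
  rw [maurerCartanChart_one, leftTangentChart_one] at hzero
  refine eq_neg_of_add_eq_zero_right ?_
  simpa using DFunLike.congr_fun (DFunLike.congr_fun hzero v) w

lemma mpullbackWithin_mulInvariantVectorField_eventuallyEq (ζ : GroupLieAlgebra I H) :
    (fun a : E => (VectorField.mpullbackWithin 𝓘(ℝ, E) I (extChartAt I (1 : H)).symm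
        (mulInvariantVectorField (I := I) (G := H) ζ) (range I) a : E))
      =ᶠ[𝓝 (chartOne I H)] fun a => leftTangentChart I H a ζ := by
  filter_upwards [eventually_mem_target_chartOne (I := I) (H := H)] with a ha
  have hinv : (mfderivWithin 𝓘(ℝ, E) I (extChartAt I (1 : H)).symm (range I) a).inverse
      = mfderiv I 𝓘(ℝ, E) (extChartAt I (1 : H)) ((extChartAt I (1 : H)).symm a) :=
    ContinuousLinearMap.inverse_eq
      (mfderivWithin_extChartAt_symm_comp_mfderiv_extChartAt ha)
      (mfderiv_extChartAt_comp_mfderivWithin_extChartAt_symm ha)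
  rw [leftTangentChart_eq ha, VectorField.mpullbackWithin_apply, hinv]
  rfl

lemma bracket_eq_fderiv_leftTangentChart (ξ η : GroupLieAlgebra I H) :
    ⁅ξ, η⁆ = fderiv ℝ (leftTangentChart I H) (chartOne I H) ξ η
      - fderiv ℝ (leftTangentChart I H) (chartOne I H) η ξ := by
  have hderiv : ∀ v ζ : E, fderiv ℝ (fun a => leftTangentChart I H a ζ) (chartOne I H) v
      = fderiv ℝ (leftTangentChart I H) (chartOne I H) v ζ := fun v ζ => by
    have hleft := (contDiffAt_leftTangentChart (I := I) (H := H)).differentiableAt (by simp)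
    rw [(hleft.hasFDerivAt.clm_apply (hasFDerivAt_const ζ _)).fderiv]
    simp
  have hinv : ((mfderiv I 𝓘(ℝ, E) (extChartAt I (1 : H)) (1 : H)).inverse : E →L[ℝ] E)
      = ContinuousLinearMap.id ℝ E := by
    rw [mfderiv_extChartAt_self]
    exact ContinuousLinearMap.inverse_id
  have hsource : (extChartAt I (1 : H)).symm ⁻¹' univ ∩ range I = univ := by
    rw [I.range_eq_univ, preimage_univ, univ_inter]
  let V : E → E → E := fun ζ => VectorField.mpullbackWithin 𝓘(ℝ, E) I (extChartAt I (1 : H)).symm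
    (mulInvariantVectorField (I := I) (G := H) ζ) (range I)
  have hbracket : ⁅ξ, η⁆ = VectorField.lieBracketWithin ℝ (V ξ) (V η)
      ((extChartAt I (1 : H)).symm ⁻¹' univ ∩ range I) (chartOne I H) :=
    DFunLike.congr_fun hinv _
  rw [hsource, VectorField.lieBracketWithin_univ] at hbracket
  refine hbracket.trans ((Filter.EventuallyEq.lieBracket_vectorField_eq
    (mpullbackWithin_mulInvariantVectorField_eventuallyEq ξ)
    (mpullbackWithin_mulInvariantVectorField_eventuallyEq η)).trans ?_)
  have hone : ∀ ζ : E, leftTangentChart I H (chartOne I H) ζ = ζ := fun ζ =>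
    DFunLike.congr_fun leftTangentChart_one ζ
  exact congrArg₂ (fun a b : E => a - b)
    ((congrArg _ (hone ξ)).trans (hderiv ξ η)) ((congrArg _ (hone η)).trans (hderiv η ξ))

lemma fderiv_maurerCartanChart_rightTangentChart (ξ η : E) :
    fderiv ℝ (fun a => maurerCartanChart I H a (rightTangentChart I H a η)) (chartOne I H) ξ
      = -(fderiv ℝ (leftTangentChart I H) (chartOne I H) ξ η
        - fderiv ℝ (leftTangentChart I H) (chartOne I H) η ξ) := by
  have hmc := (contDiffAt_maurerCartanChart (I := I) (H := H)).differentiableAt (by simp)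
  have hright := (contDiffAt_rightTangentChart (I := I) (H := H)).differentiableAt (by simp)
  have h := hmc.hasFDerivAt.clm_apply (hright.hasFDerivAt.clm_apply (hasFDerivAt_const η _))
  refine (DFunLike.congr_fun h.fderiv ξ).trans ?_
  rw [maurerCartanChart_one, rightTangentChart_one]
  simp [sub_eq_add_neg, fderiv_rightTangentChart_apply, fderiv_maurerCartanChart_apply]

lemma hasMFDerivAt_Ad_inv (η : GroupLieAlgebra I H) :
    ∃ A : E →L[ℝ] E, HasMFDerivAt I 𝓘(ℝ, E) (M' := E) (fun g : H => Ad I g⁻¹ η) (1 : H) A ∧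
      ∀ ξ : GroupLieAlgebra I H, A ξ = -⁅ξ, η⁆ := by
  have hmc := (contDiffAt_maurerCartanChart (I := I) (H := H)).differentiableAt (by simp)
  have hright := (contDiffAt_rightTangentChart (I := I) (H := H)).differentiableAt (by simp)
  have h : DifferentiableAt ℝ (fun a => maurerCartanChart I H a (rightTangentChart I H a (η : E)))
      (chartOne I H) :=
    hmc.clm_apply (hright.clm_apply (differentiableAt_const (η : E)))
  refine ⟨_, (HasMFDerivAt.comp (1 : H) h.hasFDerivAt.hasMFDerivAt
    (hasMFDerivAt_extChartAt_self 1)).congr_of_eventuallyEq ?_,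
    fun ξ => ?_⟩
  · filter_upwards [extChartAt_source_mem_nhds (I := I) (1 : H)] with g hg
    have hAd := maurerCartanChart_comp_rightTangentChart ((extChartAt I (1 : H)).map_source hg)
    rw [(extChartAt I (1 : H)).left_inv hg] at hAd
    exact (DFunLike.congr_fun hAd (η : E)).symm
  · have hbracket := congrArg (fun v : E => -v) (bracket_eq_fderiv_leftTangentChart ξ η).symm
    exact (fderiv_maurerCartanChart_rightTangentChart (I := I) (H := H) ξ η).trans hbracket

end LieGroupChart

section Cotangent

variable {E : Type*} [NormedAddCommGroup E] [NormedSpace ℝ E]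
  {X : Type*} [TopologicalSpace X] {I : ModelWithCorners ℝ E X}
  {M : Type*} [TopologicalSpace M] [ChartedSpace X M] [IsManifold I ∞ M]
  {F : Type*} [NormedAddCommGroup F] [NormedSpace ℝ F]
  {Y : Type*} [TopologicalSpace Y] {J : ModelWithCorners ℝ F Y}
  {N : Type*} [TopologicalSpace N] [ChartedSpace Y N]

lemma inCoordinates_dual (x₀ x : M) (α : TangentSpace I x →L[ℝ] ℝ) :
    ContinuousLinearMap.inCoordinates E (TangentSpace I) ℝ (fun _ : M => ℝ) x₀ x x₀ x α
      = α.comp ((trivializationAt E (TangentSpace I) x₀).symmL ℝ x) := by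
  have htriv := Bundle.Trivial.continuousLinearMapAt_trivialization ℝ M ℝ x
  change ((Bundle.Trivial.trivialization M ℝ).continuousLinearMapAt ℝ x).comp _ = _
  rw [htriv]
  rfl

lemma extChartAt_cotangent_apply (α₀ β : CotangentBundle I M) :
    extChartAt (cotangentModel I) α₀ β = (extChartAt I α₀.proj β.proj,
      β.snd.comp ((trivializationAt E (TangentSpace I) α₀.proj).symmL ℝ β.proj)) := by
  rw [FiberBundle.extChartAt, ← inCoordinates_dual]
  rfl

lemma proj_mem_extChartAt_source {α₀ β : CotangentBundle I M}
    (hβ : β ∈ (extChartAt (cotangentModel I) α₀).source) :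
    β.proj ∈ (extChartAt I α₀.proj).source := by
  rw [FiberBundle.extChartAt] at hβ
  simp only [mfld_simps] at hβ ⊢
  simpa using hβ.1

lemma proj_extChartAt_cotangent_symm {α₀ : CotangentBundle I M} {a : E × (E →L[ℝ] ℝ)}
    (ha : a ∈ (extChartAt (cotangentModel I) α₀).target) :
    ((extChartAt (cotangentModel I) α₀).symm a).proj = (extChartAt I α₀.proj).symm a.1 := by
  have hright := (extChartAt (cotangentModel I) α₀).right_inv ha
  rw [extChartAt_cotangent_apply] at hright
  rw [← congrArg Prod.fst hright, (extChartAt I α₀.proj).left_inv]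
  exact proj_mem_extChartAt_source ((extChartAt (cotangentModel I) α₀).map_target ha)

lemma mdifferentiableAt_cotangent_proj (α : CotangentBundle I M) :
    MDifferentiableAt (cotangentModel I) I (fun β : CotangentBundle I M => β.proj) α :=
  (Bundle.contMDiff_proj (n := ∞) (IB := I) (F := E →L[ℝ] ℝ)
    (fun g : M => TangentSpace I g →L[ℝ] ℝ)).contMDiffAt.mdifferentiableAt (by simp)

lemma pullback_canonicalOneForm_apply {f : N → CotangentBundle I M} {x : N}
    (hf : MDifferentiableAt J (cotangentModel I) f x) (v : Fin 1 → TangentSpace J x) :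
    pullback J (cotangentModel I) f (canonicalOneForm I M) x v
      = (f x).snd (mfderiv J I (fun y => (f y).proj) x (v 0)) := by
  have h := (mdifferentiableAt_cotangent_proj (f x)).hasMFDerivAt.comp x hf.hasMFDerivAt
  exact congrArg (f x).snd (DFunLike.congr_fun h.mfderiv (v 0)).symm

variable [I.Boundaryless]

lemma chartRep_canonicalOneForm_apply (α₀ : CotangentBundle I M) {a : E × (E →L[ℝ] ℝ)}
    (ha : a ∈ (extChartAt (cotangentModel I) α₀).target) (v : Fin 1 → E × (E →L[ℝ] ℝ)) :
    chartRep (cotangentModel I) (canonicalOneForm I M) α₀ a v = a.2 (v 0).1 := by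
  have hsource := proj_mem_extChartAt_source ((extChartAt (cotangentModel I) α₀).map_target ha)
  have hright := (extChartAt (cotangentModel I) α₀).right_inv ha
  rw [extChartAt_cotangent_apply, symmL_trivializationAt_eq hsource] at hright
  have ha₁ : a.1 ∈ (extChartAt I α₀.proj).target := by
    rw [FiberBundle.extChartAt_target] at ha
    exact ha.1.1
  have hfst : HasMFDerivAt 𝓘(ℝ, E × (E →L[ℝ] ℝ)) I
      (fun b : E × (E →L[ℝ] ℝ) => (extChartAt I α₀.proj).symm b.1) a
      ((mfderiv 𝓘(ℝ, E) I (extChartAt I α₀.proj).symm a.1 : E →L[ℝ] E).comp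
        (ContinuousLinearMap.fst ℝ E (E →L[ℝ] ℝ))) :=
    HasMFDerivAt.comp a (I' := 𝓘(ℝ, E)) (mdifferentiableAt_extChartAt_symm ha₁).hasMFDerivAt
      hasFDerivAt_fst.hasMFDerivAt
  have hproj := hfst.congr_of_eventuallyEq (mem_of_superset (extChartAt_target_mem_nhds' ha)
    fun b hb => proj_extChartAt_cotangent_symm hb)
  refine (pullback_canonicalOneForm_apply (mdifferentiableAt_extChartAt_symm ha) v).trans ?_
  have hbase := congrArg Prod.fst hright
  have hfibre := congrArg Prod.snd hright
  simp only at hbase hfibre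
  rw [hbase] at hfibre
  rw [hproj.mfderiv, ← hfibre]
  rfl

lemma smoothFormAt_canonicalOneForm (α₀ : CotangentBundle I M) :
    SmoothFormAt (cotangentModel I) (canonicalOneForm I M) α₀ := by
  let L : E × (E →L[ℝ] ℝ) →L[ℝ] (E × (E →L[ℝ] ℝ)) [⋀^Fin 1]→L[ℝ] ℝ :=
    (ContinuousAlternatingMap.ofSubsingletonLIE (𝕜 := ℝ) (E := E × (E →L[ℝ] ℝ)) (F := ℝ)
      (0 : Fin 1)).toContinuousLinearEquiv.toContinuousLinearMap.comp
      ((ContinuousLinearMap.precomp ℝ (ContinuousLinearMap.fst ℝ E (E →L[ℝ] ℝ))).comp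
        (ContinuousLinearMap.snd ℝ E (E →L[ℝ] ℝ)))
  refine ContDiffAt.congr_of_eventuallyEq L.contDiff.contDiffAt ?_
  filter_upwards [extChartAt_target_mem_nhds (I := cotangentModel I) α₀] with a ha
  ext v
  exact chartRep_canonicalOneForm_apply α₀ ha v

end Cotangent

section TrivInv

variable {E : Type*} [NormedAddCommGroup E] [NormedSpace ℝ E]
  {X : Type*} [TopologicalSpace X] {I : ModelWithCorners ℝ E X}
  {H : Type*} [TopologicalSpace H] [ChartedSpace X H] [Group H] [LieGroup I ∞ H]

variable (I) in
/-- The inverse left trivialization `(g, μ) ↦ μ ∘ T L_{g⁻¹}` of the cotangent bundle. -/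
def leftTrivializationSymm (y : H × LieDual I H) : CotangentBundle I H :=
  ⟨y.1, ContinuousLinearMap.comp (M₂ := E) y.2 (leftTangentInv I y.1)⟩

lemma contMDiff_leftTrivializationSymm :
    ContMDiff (I.prod 𝓘(ℝ, E →L[ℝ] ℝ)) (cotangentModel I) ∞
      (leftTrivializationSymm I : H × LieDual I H → CotangentBundle I H) := by
  intro y₀
  rw [contMDiffAt_hom_bundle]
  refine ⟨contMDiffAt_fst, ?_⟩
  have hfst : ContMDiffAt (I.prod 𝓘(ℝ, E →L[ℝ] ℝ)) 𝓘(ℝ, E →L[ℝ] E) ∞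
      (fun y : H × LieDual I H => maurerCartanCoord I y₀.1 y.1) y₀ :=
    ContMDiffAt.comp y₀ (contMDiffAt_maurerCartanCoord y₀.1) contMDiffAt_fst
  have hsnd : ContMDiffAt (I.prod 𝓘(ℝ, E →L[ℝ] ℝ)) 𝓘(ℝ, E →L[ℝ] ℝ) ∞
      (fun y : H × LieDual I H => y.2) y₀ := contMDiffAt_snd
  exact (hsnd.clm_comp hfst).congr_of_eventuallyEq
    (Eventually.of_forall fun y => inCoordinates_dual y₀.1 y.1 _)

end TrivInv

section LeftTranslation

variable {E : Type*} [NormedAddCommGroup E] [NormedSpace ℝ E]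
  {X : Type*} [TopologicalSpace X] {I : ModelWithCorners ℝ E X}
  {H : Type*} [TopologicalSpace H] [ChartedSpace X H] [Group H]
  {F : Type*} [NormedAddCommGroup F] [NormedSpace ℝ F]
  {Y : Type*} [TopologicalSpace Y] {J : ModelWithCorners ℝ F Y}
  {N : Type*} [TopologicalSpace N] [ChartedSpace Y N]

/-- The action of `h` on `H × N` by left translation of the first factor, generalizing
`bodyAct`. -/
def leftTranslate (h : H) (z : H × N) : H × N := (h * z.1, z.2)

variable [LieGroup I ∞ H]

lemma hasMFDerivAt_mul_left (h g : H) :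
    HasMFDerivAt I I (fun k : H => h * k) g (mfderiv I I (fun k : H => h * k) g) :=
  ((contMDiff_mul_left (I := I) (n := ∞)).contMDiffAt.mdifferentiableAt (by simp)).hasMFDerivAt

lemma leftTangentInv_mul (h g : H) (v : TangentSpace I g) :
    leftTangentInv I (h * g) (mfderiv I I (fun k : H => h * k) g v) = leftTangentInv I g v := by
  have hcomp := HasMFDerivAt.comp g (hasMFDerivAt_mul_left_inv (I := I) (h * g))
    (hasMFDerivAt_mul_left h g)
  have hfun : (fun k : H => (h * g)⁻¹ * k) ∘ (fun k : H => h * k) = fun k => g⁻¹ * k := by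
    ext k
    simp [mul_assoc]
  rw [hfun] at hcomp
  exact (DFunLike.congr_fun hcomp.mfderiv v).symm

lemma hasMFDerivAt_leftTranslate (h : H) (z : H × N) :
    HasMFDerivAt (I.prod J) (I.prod J) (leftTranslate h : H × N → H × N) z
      (((mfderiv I I (fun k : H => h * k) z.1 : E →L[ℝ] E).comp
        (ContinuousLinearMap.fst ℝ E F)).prod (ContinuousLinearMap.snd ℝ E F)) :=
  HasMFDerivAt.prodMk (HasMFDerivAt.comp z (hasMFDerivAt_mul_left h z.1) (hasMFDerivAt_fst z))
    (hasMFDerivAt_snd z)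

lemma contMDiff_leftTranslate (h : H) :
    ContMDiff (I.prod J) (I.prod J) ∞ (leftTranslate h : H × N → H × N) :=
  (contMDiff_mul_left.comp contMDiff_fst).prodMk contMDiff_snd

lemma apply_eq_of_pullback_leftTranslate_eq {k : ℕ} {Ω : DiffForm (I.prod J) (H × N) k}
    (hΩ : ∀ h : H, pullback (I.prod J) (I.prod J) (leftTranslate h) Ω = Ω) (g : H) (y : N)
    (v : Fin k → E × F) :
    Ω (g, y) v = Ω (1, y) fun i => (leftTangentInv I g (v i).1, (v i).2) := by
  have hone : leftTranslate g⁻¹ (g, y) = (1, y) := Prod.ext (inv_mul_cancel g) rfl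
  refine (DFunLike.congr_fun (congrFun (hΩ g⁻¹) (g, y)) v).symm.trans ?_
  exact pullback_apply_of_hasMFDerivAt hone (hasMFDerivAt_leftTranslate g⁻¹ (g, y)) v

end LeftTranslation

section LeftTrivializedOneForm

variable {E : Type*} [NormedAddCommGroup E] [NormedSpace ℝ E]
  {X : Type*} [TopologicalSpace X] {I : ModelWithCorners ℝ E X}
  {H : Type*} [TopologicalSpace H] [ChartedSpace X H] [Group H] [LieGroup I ∞ H]
  {F : Type*} [NormedAddCommGroup F] [NormedSpace ℝ F]
  {Y : Type*} [TopologicalSpace Y] {J : ModelWithCorners ℝ F Y}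
  {N : Type*} [TopologicalSpace N] [ChartedSpace Y N]
  {m : N → LieDual I H}

variable (I J) in
/-- The one-form `⟨m, λ⟩` on `H × N`, where `λ` is the left Maurer-Cartan form of `H`, as the
pull-back of the canonical one-form along `(g, y) ↦ m y ∘ T L_{g⁻¹}`. -/
def leftTrivializedOneForm (m : N → LieDual I H) : DiffForm (I.prod J) (H × N) 1 :=
  pullback (I.prod J) (cotangentModel I) (fun z : H × N => leftTrivializationSymm I (z.1, m z.2))
    (canonicalOneForm I H)

lemma contMDiff_leftTrivializationSymm_comp (hm : ContMDiff J 𝓘(ℝ, E →L[ℝ] ℝ) ∞ m) :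
    ContMDiff (I.prod J) (cotangentModel I) ∞
      (fun z : H × N => leftTrivializationSymm I (z.1, m z.2)) :=
  contMDiff_leftTrivializationSymm.comp (contMDiff_fst.prodMk (hm.comp contMDiff_snd))

lemma leftTrivializedOneForm_apply (hm : ContMDiff J 𝓘(ℝ, E →L[ℝ] ℝ) ∞ m) (z : H × N)
    (v : Fin 1 → E × F) :
    leftTrivializedOneForm I J m z v = m z.2 (leftTangentInv I z.1 (v 0).1) := by
  have hdiff := (contMDiff_leftTrivializationSymm_comp hm z).mdifferentiableAt (by simp)
  have hfst : mfderiv (I.prod J) I (fun y : H × N => y.1) z = ContinuousLinearMap.fst ℝ E F :=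
    (hasMFDerivAt_fst z).mfderiv
  refine (pullback_canonicalOneForm_apply hdiff v).trans ?_
  exact congrArg (fun A : E × F →L[ℝ] E => m z.2 (leftTangentInv I z.1 (A (v 0)))) hfst

lemma pullback_leftTranslate_leftTrivializedOneForm (hm : ContMDiff J 𝓘(ℝ, E →L[ℝ] ℝ) ∞ m)
    (h : H) :
    pullback (I.prod J) (I.prod J) (leftTranslate h) (leftTrivializedOneForm I J m)
      = leftTrivializedOneForm I J m := by
  funext z
  ext v
  refine (pullback_apply_of_hasMFDerivAt rfl (hasMFDerivAt_leftTranslate h z) v).trans ?_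
  refine (leftTrivializedOneForm_apply hm _ _).trans ?_
  exact (congrArg (m z.2) (leftTangentInv_mul h z.1 (v 0).1)).trans
    (leftTrivializedOneForm_apply hm z v).symm

variable [I.Boundaryless] [J.Boundaryless] [IsManifold J ∞ N]

lemma smoothFormAt_leftTrivializedOneForm
    (hm : ContMDiff J 𝓘(ℝ, E →L[ℝ] ℝ) ∞ m) (z : H × N) :
    SmoothFormAt (I.prod J) (leftTrivializedOneForm I J m) z :=
  (smoothFormAt_canonicalOneForm _).pullback
    (contMDiff_leftTrivializationSymm_comp hm).contMDiffAt

lemma pullback_leftTranslate_extD_leftTrivializedOneForm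
    (hm : ContMDiff J 𝓘(ℝ, E →L[ℝ] ℝ) ∞ m) (h : H) :
    pullback (I.prod J) (I.prod J) (leftTranslate h)
        (extD (I.prod J) (leftTrivializedOneForm I J m))
      = extD (I.prod J) (leftTrivializedOneForm I J m) := by
  funext z
  rw [← extD_pullback (contMDiff_leftTranslate h).contMDiffAt
    (smoothFormAt_leftTrivializedOneForm hm _), pullback_leftTranslate_leftTrivializedOneForm hm]

lemma chartRep_leftTrivializedOneForm_apply
    (hm : ContMDiff J 𝓘(ℝ, E →L[ℝ] ℝ) ∞ m)
    (y : N) {a : E × F} (ha : a ∈ (extChartAt (I.prod J) ((1 : H), y)).target)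
    (v : Fin 1 → E × F) :
    chartRep (I.prod J) (leftTrivializedOneForm I J m) ((1 : H), y) a v
      = m ((extChartAt J y).symm a.2) (maurerCartanChart I H a.1 (v 0).1) := by
  let p : H × N := (extChartAt (I.prod J) ((1 : H), y)).symm a
  let dp : E × F →L[ℝ] E × F :=
    mfderiv 𝓘(ℝ, E × F) (I.prod J) (extChartAt (I.prod J) ((1 : H), y)).symm a
  refine (leftTrivializedOneForm_apply hm p fun i => dp (v i)).trans ?_
  exact congrArg (fun w : E => m p.2 (leftTangentInv I p.1 w))
    (mfderiv_extChartAt_prod_symm_fst ((1 : H), y) ha (v 0))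

lemma fderiv_chartRep_leftTrivializedOneForm_apply
    (hm : ContMDiff J 𝓘(ℝ, E →L[ℝ] ℝ) ∞ m) (y : N)
    {A : F →L[ℝ] E →L[ℝ] ℝ} (hA : HasMFDerivAt J 𝓘(ℝ, E →L[ℝ] ℝ) m y A) (v w : E × F) :
    fderiv ℝ (fun a => chartRep (I.prod J) (leftTrivializedOneForm I J m) ((1 : H), y) a ![w])
        (chartOne I H, extChartAt J y y) v
      = A v.2 w.1 - m y (fderiv ℝ (leftTangentChart I H) (chartOne I H) v.1 w.1) := by
  have hmc := (contDiffAt_maurerCartanChart (I := I) (H := H)).differentiableAt (by simp)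
  have hcoord : HasFDerivAt (fun a : E × F => maurerCartanChart I H a.1) _
      (chartOne I H, extChartAt J y y) :=
    HasFDerivAt.comp (g := maurerCartanChart I H) (f := Prod.fst) _ hmc.hasFDerivAt hasFDerivAt_fst
  have hmomentum : HasFDerivAt (fun a : E × F => m ((extChartAt J y).symm a.2)) _
      (chartOne I H, extChartAt J y y) :=
    HasFDerivAt.comp (g := m ∘ (extChartAt J y).symm) (f := Prod.snd) _
      (hasFDerivAt_comp_extChartAt_symm hA) hasFDerivAt_snd
  have heq : (fun a => chartRep (I.prod J) (leftTrivializedOneForm I J m) ((1 : H), y) a ![w])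
      =ᶠ[𝓝 (chartOne I H, extChartAt J y y)]
        fun a => m ((extChartAt J y).symm a.2) (maurerCartanChart I H a.1 w.1) := by
    filter_upwards [extChartAt_target_mem_nhds (I := I.prod J) ((1 : H), y)] with a ha
    exact chartRep_leftTrivializedOneForm_apply hm y ha ![w]
  rw [heq.fderiv_eq, (hmomentum.clm_apply (hcoord.clm_apply (hasFDerivAt_const w.1 _))).fderiv,
    maurerCartanChart_one]
  simp [fderiv_maurerCartanChart_apply, sub_eq_neg_add]

lemma extD_leftTrivializedOneForm_one_apply
    (hm : ContMDiff J 𝓘(ℝ, E →L[ℝ] ℝ) ∞ m) (y : N) {A : F →L[ℝ] E →L[ℝ] ℝ}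
    (hA : HasMFDerivAt J 𝓘(ℝ, E →L[ℝ] ℝ) m y A) (ξ η : GroupLieAlgebra I H) (u w : F) :
    extD (I.prod J) (leftTrivializedOneForm I J m) ((1 : H), y) ![(ξ, u), (η, w)]
      = A u η - A w ξ - m y (⁅ξ, η⁆ : GroupLieAlgebra I H) := by
  have hdiff := (smoothFormAt_leftTrivializedOneForm hm ((1 : H), y)).differentiableAt
  have hbracket := congrArg (m y) (bracket_eq_fderiv_leftTangentChart ξ η)
  have hsub := map_sub (m y) (fderiv ℝ (leftTangentChart I H) (chartOne I H) ξ η)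
    (fderiv ℝ (leftTangentChart I H) (chartOne I H) η ξ)
  rw [extD_eq_extDeriv]
  refine (extDeriv_one_apply hdiff (ξ, u) (η, w)).trans ?_
  refine (congrArg₂ (· - ·)
    (fderiv_chartRep_leftTrivializedOneForm_apply hm y hA (ξ, u) (η, w))
    (fderiv_chartRep_leftTrivializedOneForm_apply hm y hA (η, w) (ξ, u))).trans ?_
  rw [hbracket.trans hsub]
  ring

end LeftTrivializedOneForm

section Potential

variable {E : Type*} [NormedAddCommGroup E] [NormedSpace ℝ E]
  {X : Type*} [TopologicalSpace X] {I : ModelWithCorners ℝ E X}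
  {H : Type*} [TopologicalSpace H] [ChartedSpace X H]
  {F : Type*} [NormedAddCommGroup F] [NormedSpace ℝ F]
  {Y : Type*} [TopologicalSpace Y] {J : ModelWithCorners ℝ F Y}
  {P : Type*} [TopologicalSpace P] [ChartedSpace Y P]

lemma hasMFDerivAt_clm_apply_const {f : P → E →L[ℝ] ℝ} {x : P} {A : F →L[ℝ] E →L[ℝ] ℝ}
    (hf : HasMFDerivAt J 𝓘(ℝ, E →L[ℝ] ℝ) f x A) (η : E) :
    HasMFDerivAt J 𝓘(ℝ, ℝ) (fun y => f y η) x ((ContinuousLinearMap.apply ℝ ℝ η).comp A) :=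
  HasMFDerivAt.comp x (ContinuousLinearMap.apply ℝ ℝ η).hasFDerivAt.hasMFDerivAt hf

lemma bracket_swap [Group H] (ξ η : GroupLieAlgebra I H) : ⁅ξ, η⁆ = -⁅η, ξ⁆ :=
  VectorField.mlieBracket_swap_apply

lemma bracket_zero_left [Group H] (η : GroupLieAlgebra I H) :
    ⁅(0 : GroupLieAlgebra I H), η⁆ = 0 := by
  have hzero : mulInvariantVectorField (0 : GroupLieAlgebra I H) = 0 :=
    funext fun g => map_zero _
  rw [GroupLieAlgebra.bracket_def, hzero, VectorField.mlieBracket_zero_left]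
  rfl

lemma hasMFDerivAt_prodMk_left (g : H) (x : P) :
    HasMFDerivAt J (I.prod J) (fun y : P => (g, y)) x
      ((0 : F →L[ℝ] E).prod (ContinuousLinearMap.id ℝ F)) :=
  (hasMFDerivAt_const g x).prodMk (hasMFDerivAt_id x)

lemma apply_vertical {B : DiffForm (I.prod J) (H × P) 2} {ωP : DiffForm J P 2} {g : H} {x : P}
    (hB : pullback J (I.prod J) (fun y : P => (g, y)) B x = -ωP x) (u w : F) :
    B (g, x) ![((0 : E), u), (0, w)] = -ωP x ![u, w] := by
  have hpull := pullback_apply_of_hasMFDerivAt (Ω := B) rfl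
    (hasMFDerivAt_prodMk_left (I := I) (J := J) g x) ![u, w]
  have hvec : (fun i => ((0 : F →L[ℝ] E).prod (ContinuousLinearMap.id ℝ F))
      ((![u, w] : Fin 2 → F) i)) = ![((0 : E), u), (0, w)] := by
    ext i <;> fin_cases i <;> rfl
  exact (congrArg (B (g, x)) hvec).symm.trans
    (hpull.symm.trans (DFunLike.congr_fun hB (![u, w] : Fin 2 → F)))

variable [Group H] [MulAction H P] {B : DiffForm (I.prod J) (H × P) 2} {φ : H × P → LieDual I H}

lemma apply_fundField_vertical (hφ : IsBgPotential I J B φ) {x : P} {A : F →L[ℝ] E →L[ℝ] ℝ}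
    (hA : HasMFDerivAt J 𝓘(ℝ, E →L[ℝ] ℝ) (fun y => φ (1, y)) x A) (ξ : GroupLieAlgebra I H)
    (u : F) :
    B (1, x) ![fundField I J ξ (1, x), (0, u)] = A u ξ := by
  have hderiv := (hφ.smooth (1, x)).mdifferentiableAt (by simp) |>.hasMFDerivAt
  have hslice := (HasMFDerivAt.comp x hderiv (hasMFDerivAt_prodMk_left (I := I) (1 : H) x)).mfderiv
  have hpair := (hasMFDerivAt_clm_apply_const hderiv ξ).mfderiv
  refine (hφ.potential ξ (1, x) _).trans ((DFunLike.congr_fun hpair _).trans ?_)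
  exact congrArg (fun L : F →L[ℝ] E →L[ℝ] ℝ => L u ξ) (hslice.symm.trans hA.mfderiv)

variable [LieGroup I ∞ H] [ContMDiffSMul I J ∞ H P]

lemma contMDiff_diagAct (h : H) :
    ContMDiff (I.prod J) (I.prod J) ∞ (diagAct h : H × P → H × P) :=
  (contMDiff_mul_left.comp contMDiff_fst).prodMk
    ((contMDiff_const : ContMDiff (I.prod J) I ∞ fun _ => h).smul contMDiff_snd)

lemma contMDiff_diagAct_left (z : H × P) :
    ContMDiff I (I.prod J) ∞ (fun h : H => diagAct h z) :=
  contMDiff_mul_right.prodMk (contMDiff_id.smul contMDiff_const)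

lemma mvfderiv_potential_diagAct (hφ : IsBgPotential I J B φ) (ξ η : GroupLieAlgebra I H)
    (z : H × P) :
    mvfderiv I (fun g : H => φ (diagAct g z) η) 1 ξ
      = B z ![fundField I J η z, fundField I J ξ z] := by
  have hpair := (hasMFDerivAt_clm_apply_const
    ((hφ.smooth z).mdifferentiableAt (by simp)).hasMFDerivAt η).mdifferentiableAt
  have horbit := (contMDiff_diagAct_left (I := I) (J := J) z 1).mdifferentiableAt (by simp)
  have hone : diagAct 1 z = z := Prod.ext (one_mul _) (one_smul _ _)
  exact (mvfderiv_comp_apply_of_eq 1 hpair horbit hone ξ).trans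
    (hφ.potential η z (fundField I J ξ z)).symm

lemma twoCocycle_eq [I.Boundaryless] (hφ : IsBgPotential I J B φ) (ξ η : GroupLieAlgebra I H)
    (z : H × P) :
    twoCocycle I φ ξ η z
      = B z ![fundField I J ξ z, fundField I J η z] - φ z (⁅ξ, η⁆ : GroupLieAlgebra I H) := by
  obtain ⟨A, hA, hAξ⟩ := hasMFDerivAt_Ad_inv (I := I) (H := H) η
  have hcoAd : HasMFDerivAt I 𝓘(ℝ, ℝ) (fun g : H => φ z (Ad I g⁻¹ η)) 1 ((φ z).comp A) :=
    HasMFDerivAt.comp (M' := E) (1 : H) (φ z).hasFDerivAt.hasMFDerivAt hA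
  have hpotential := hasMFDerivAt_clm_apply_const
    (((hφ.smooth.comp (contMDiff_diagAct_left z)) 1).mdifferentiableAt (by simp)).hasMFDerivAt η
  have hfst := (DFunLike.congr_fun hpotential.mfderiv ξ).symm.trans
    (mvfderiv_potential_diagAct hφ ξ η z)
  have hsnd : φ z (A ξ) = -φ z (⁅ξ, η⁆ : GroupLieAlgebra I H) :=
    (congrArg (φ z) (hAξ ξ)).trans (map_neg (φ z) _)
  refine (DFunLike.congr_fun (hpotential.neg.add hcoAd).mfderiv ξ).trans ?_
  refine (congrArg₂ (fun s t : ℝ => -s + t) hfst hsnd).trans ?_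
  rw [← sub_eq_add_neg]
  exact congrArg (· - φ z (⁅ξ, η⁆ : GroupLieAlgebra I H))
    (twoForm_swap (E := E × F) (B z) (fundField I J ξ z) (fundField I J η z)).symm

lemma twoCocycle_swap [I.Boundaryless] (hφ : IsBgPotential I J B φ) (ξ η : GroupLieAlgebra I H)
    (z : H × P) :
    twoCocycle I φ ξ η z = -twoCocycle I φ η ξ z := by
  have hbracket : φ z (⁅ξ, η⁆ : GroupLieAlgebra I H) = -φ z (⁅η, ξ⁆ : GroupLieAlgebra I H) :=
    (congrArg (φ z) (bracket_swap ξ η)).trans (map_neg (φ z) _)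
  have hB := twoForm_swap (E := E × F) (B z) (fundField I J ξ z) (fundField I J η z)
  rw [twoCocycle_eq hφ, twoCocycle_eq hφ, hbracket]
  refine (congrArg (· - -φ z (⁅η, ξ⁆ : GroupLieAlgebra I H)) hB).trans ?_
  exact (neg_sub_neg _ _).trans (neg_sub _ _).symm

end Potential

section BodyCoordinates

variable {E : Type*} [NormedAddCommGroup E] [NormedSpace ℝ E]
  {X : Type*} [TopologicalSpace X] {I : ModelWithCorners ℝ E X}
  {H : Type*} [TopologicalSpace H] [ChartedSpace X H] [Group H]
  {F : Type*} [NormedAddCommGroup F] [NormedSpace ℝ F]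
  {Y : Type*} [TopologicalSpace Y] {J : ModelWithCorners ℝ F Y}
  {P : Type*} {φ : H × P → LieDual I H}

/-- The momentum `(μ, x) ↦ μ + φ(e, x)` with which `H × 𝔥^* × P` maps to `T^*H` after undoing the
shift. -/
def unshiftedMomentum (φ : H × P → LieDual I H) (y : LieDual I H × P) : LieDual I H :=
  y.1 + φ (1, y.2)

variable (I) in
/-- The map `(g, μ, x) ↦ (g, g · x)` from body to spatial coordinates on `H × P`. -/
def spatialMap [MulAction H P] (z : H × (LieDual I H × P)) : H × P := (z.1, z.1 • z.2.2)

lemma spatialMap_comp_leftTranslate [MulAction H P] (h : H) :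
    (spatialMap I ∘ leftTranslate h : H × (LieDual I H × P) → H × P)
      = diagAct h ∘ spatialMap I :=
  funext fun z => Prod.ext rfl (mul_smul h z.1 z.2.2)

variable [TopologicalSpace P] [ChartedSpace Y P]

lemma hasMFDerivAt_unshiftedMomentum {x : P} {A : F →L[ℝ] E →L[ℝ] ℝ}
    (hA : HasMFDerivAt J 𝓘(ℝ, E →L[ℝ] ℝ) (fun y => φ (1, y)) x A) (ν : LieDual I H) :
    HasMFDerivAt (𝓘(ℝ, E →L[ℝ] ℝ).prod J) 𝓘(ℝ, E →L[ℝ] ℝ) (unshiftedMomentum φ) (ν, x)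
      (ContinuousLinearMap.fst ℝ (E →L[ℝ] ℝ) F
        + A.comp (ContinuousLinearMap.snd ℝ (E →L[ℝ] ℝ) F)) :=
  (hasMFDerivAt_fst (ν, x)).add
    (HasMFDerivAt.comp (g := fun y => φ (1, y)) (f := Prod.snd) (ν, x) hA
      (hasMFDerivAt_snd (ν, x)))

lemma contMDiff_unshiftedMomentum (hφ : ContMDiff (I.prod J) 𝓘(ℝ, E →L[ℝ] ℝ) ∞ φ) :
    ContMDiff (𝓘(ℝ, E →L[ℝ] ℝ).prod J) 𝓘(ℝ, E →L[ℝ] ℝ) ∞ (unshiftedMomentum φ) :=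
  contMDiff_fst.add (hφ.comp (contMDiff_const.prodMk contMDiff_snd))

lemma contMDiff_shiftMap_symm (hφ : ContMDiff (I.prod J) 𝓘(ℝ, E →L[ℝ] ℝ) ∞ φ) :
    ContMDiff (bodyModel I J) (bodyModel I J) ∞ (shiftMap I φ).symm :=
  contMDiff_fst.prodMk (((contMDiff_unshiftedMomentum hφ).comp contMDiff_snd).prodMk
    (contMDiff_snd.comp contMDiff_snd))

variable [MulAction H P] [ContMDiffSMul I J ∞ H P]

lemma contMDiff_spatialMap :
    ContMDiff (bodyModel I J) (I.prod J) ∞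
      (spatialMap I : H × (LieDual I H × P) → H × P) :=
  contMDiff_fst.prodMk (contMDiff_fst.smul (contMDiff_snd.comp contMDiff_snd))

lemma contMDiff_bodyMap_symm [LieGroup I ∞ H] :
    ContMDiff (bodyModel I J) ((cotangentModel I).prod J) ∞ (bodyMap I H P).symm :=
  (contMDiff_leftTrivializationSymm_comp contMDiff_fst).prodMk
    (contMDiff_fst.smul (contMDiff_snd.comp contMDiff_snd))

end BodyCoordinates

section ShiftedForm

variable {E : Type*} [NormedAddCommGroup E] [NormedSpace ℝ E]
  {X : Type*} [TopologicalSpace X] {I : ModelWithCorners ℝ E X}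
  {H : Type*} [TopologicalSpace H] [ChartedSpace X H] [Group H]
  {F : Type*} [NormedAddCommGroup F] [NormedSpace ℝ F]
  {Y : Type*} [TopologicalSpace Y] {J : ModelWithCorners ℝ F Y}
  {P : Type*} [TopologicalSpace P] [ChartedSpace Y P] [MulAction H P] [ContMDiffSMul I J ∞ H P]
  {B : DiffForm (I.prod J) (H × P) 2} {φ : H × P → LieDual I H}

lemma hasMFDerivAt_spatialMap (ν : LieDual I H) (x : P) :
    ∃ A : E × ((E →L[ℝ] ℝ) × F) →L[ℝ] E × F,
      HasMFDerivAt (bodyModel I J) (I.prod J) (spatialMap I : H × (LieDual I H × P) → H × P)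
        (1, (ν, x)) A ∧
      (∀ ξ : GroupLieAlgebra I H, A (ξ, 0, 0) = fundField I J ξ ((1 : H), x)) ∧
      ∀ (ρ : E →L[ℝ] ℝ) (u : F), A (0, ρ, u) = (0, u) := by
  let act : H × P → H × P := fun p => (p.1, p.1 • p.2)
  have hact : MDifferentiableAt (I.prod J) (I.prod J) act (1, x) :=
    (contMDiff_fst.prodMk (contMDiff_fst.smul contMDiff_snd) :
      ContMDiff (I.prod J) (I.prod J) ∞ act).mdifferentiableAt (by simp)
  have hproj : HasMFDerivAt (bodyModel I J) (I.prod J)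
      (fun z : H × (LieDual I H × P) => (z.1, z.2.2)) (1, (ν, x))
      ((ContinuousLinearMap.fst ℝ E ((E →L[ℝ] ℝ) × F)).prod
        ((ContinuousLinearMap.snd ℝ (E →L[ℝ] ℝ) F).comp
          (ContinuousLinearMap.snd ℝ E ((E →L[ℝ] ℝ) × F)))) :=
    (hasMFDerivAt_fst _).prodMk ((hasMFDerivAt_snd _).comp _ (hasMFDerivAt_snd _))
  have horbit : HasMFDerivAt I (I.prod J) (fun h : H => diagAct h ((1 : H), x)) 1 _ :=
    (HasMFDerivAt.comp (g := act) (f := fun h => (h, x)) 1 hact.hasMFDerivAt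
      ((hasMFDerivAt_id (1 : H)).prodMk (hasMFDerivAt_const x 1))).congr_of_eventuallyEq
        (Eventually.of_forall fun h => Prod.ext (mul_one h) rfl)
  have hslice := hasMFDerivAt_unique (hasMFDerivAt_prodMk_left (I := I) (1 : H) x)
    ((HasMFDerivAt.comp (g := act) x hact.hasMFDerivAt
      (hasMFDerivAt_prodMk_left (I := I) (1 : H) x)).congr_of_eventuallyEq
        (Eventually.of_forall fun y => Prod.ext rfl (one_smul H y).symm))
  have hspatial := HasMFDerivAt.comp (g := act) ((1 : H), (ν, x)) hact.hasMFDerivAt hproj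
  exact ⟨_, hspatial,
    fun ξ => (DFunLike.congr_fun horbit.mfderiv ξ).symm,
    fun _ u => (DFunLike.congr_fun hslice u).symm⟩

variable [LieGroup I ∞ H]

lemma pullback_spatialMap_apply [I.Boundaryless] (hφ : IsBgPotential I J B φ)
    {ωP : DiffForm J P 2} {x : P}
    (hB : pullback J (I.prod J) (fun y : P => ((1 : H), y)) B x = -ωP x)
    {A : F →L[ℝ] E →L[ℝ] ℝ} (hA : HasMFDerivAt J 𝓘(ℝ, E →L[ℝ] ℝ) (fun y => φ (1, y)) x A)
    (ν : LieDual I H) (ξ η : GroupLieAlgebra I H) (ρ σ : E →L[ℝ] ℝ) (u w : F) :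
    pullback (bodyModel I J) (I.prod J) (spatialMap I) B ((1 : H), (ν, x)) ![(ξ, ρ, u), (η, σ, w)]
      = twoCocycle I φ ξ η (1, x) + φ (1, x) (⁅ξ, η⁆ : GroupLieAlgebra I H)
        + A w ξ - A u η - ωP x ![u, w] := by
  obtain ⟨T, hT, hTorbit, hTslice⟩ := hasMFDerivAt_spatialMap (I := I) (J := J) (H := H) ν x
  have hbase : spatialMap I ((1 : H), (ν, x)) = (1, x) := Prod.ext rfl (one_smul H x)
  have hsplit (ζ : E) (τ : E →L[ℝ] ℝ) (v : F) : T (ζ, τ, v) = T (ζ, 0, 0) + T (0, τ, v) := by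
    rw [← map_add]
    simp
  have hvec : (fun i => T ((![(ξ, ρ, u), (η, σ, w)] : Fin 2 → E × ((E →L[ℝ] ℝ) × F)) i))
      = ![T (ξ, 0, 0) + T (0, ρ, u), T (η, 0, 0) + T (0, σ, w)] := by
    funext i
    fin_cases i <;> exact hsplit _ _ _
  have hswap := (twoForm_swap (E := E × F) (B (1, x)) (0, u) (fundField I J η (1, x))).trans
    (congrArg Neg.neg (apply_fundField_vertical hφ hA η u))
  refine (pullback_apply_of_hasMFDerivAt hbase hT _).trans ?_
  refine (congrArg (B (1, x)) hvec).trans ?_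
  refine (twoForm_add_add (E := E × F) (B (1, x)) _ _ _ _).trans ?_
  rw [hTorbit, hTorbit, hTslice, hTslice]
  refine (congrArg₂ (· + ·)
    (congrArg₂ (· + ·) (eq_add_of_sub_eq (twoCocycle_eq hφ ξ η (1, x)).symm)
      (apply_fundField_vertical hφ hA ξ w))
    (congrArg₂ (· + ·) hswap (apply_vertical hB u w))).trans ?_
  ring

variable [I.Boundaryless] [J.Boundaryless] [IsManifold J ∞ P]

lemma shiftedForm_eq (hφ : ContMDiff (I.prod J) 𝓘(ℝ, E →L[ℝ] ℝ) ∞ φ) :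
    shiftedForm I J B φ = fun z =>
      -extD (bodyModel I J)
          (leftTrivializedOneForm I (𝓘(ℝ, E →L[ℝ] ℝ).prod J) (unshiftedMomentum φ)) z
        - pullback (bodyModel I J) (I.prod J) (spatialMap I) B z := by
  funext z
  have hshift := (contMDiff_shiftMap_symm hφ z).mdifferentiableAt (by simp)
  have hbody := (contMDiff_bodyMap_symm (I := I) (J := J) ((shiftMap I φ).symm z)).mdifferentiableAt
    (by simp)
  have hψ := hbody.comp z hshift
  let ψ : H × (LieDual I H × P) → CotangentBundle I H × P :=
    (bodyMap I H P).symm ∘ (shiftMap I φ).symm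
  have hproj : ContMDiff ((cotangentModel I).prod J) (I.prod J) ∞
      (fun y : CotangentBundle I H × P => (y.1.proj, y.2)) :=
    ((Bundle.contMDiff_proj _).comp contMDiff_fst).prodMk contMDiff_snd
  have hcanonical : pullback (bodyModel I J) ((cotangentModel I).prod J) ψ
      (pullback ((cotangentModel I).prod J) (cotangentModel I) Prod.fst (canonicalForm I H)) z
      = -extD (bodyModel I J)
          (leftTrivializedOneForm I (𝓘(ℝ, E →L[ℝ] ℝ).prod J) (unshiftedMomentum φ)) z := by
    rw [leftTrivializedOneForm, extD_pullback (contMDiff_leftTrivializationSymm_comp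
      (contMDiff_unshiftedMomentum hφ)).contMDiffAt (smoothFormAt_canonicalOneForm _)]
    exact (pullback_comp mdifferentiableAt_fst hψ).symm
  have hspatial : pullback (bodyModel I J) ((cotangentModel I).prod J) ψ
      (pullback ((cotangentModel I).prod J) (I.prod J) (fun y => (y.1.proj, y.2)) B) z
      = pullback (bodyModel I J) (I.prod J) (spatialMap I) B z :=
    (pullback_comp ((hproj _).mdifferentiableAt (by simp)) hψ).symm
  exact (pullback_comp hbody hshift).symm.trans (congrArg₂ (· - ·) hcanonical hspatial)

lemma smoothFormAt_shiftedForm (hφ : ContMDiff (I.prod J) 𝓘(ℝ, E →L[ℝ] ℝ) ∞ φ)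
    (hB : IsSmoothForm (I.prod J) B) (z : H × (LieDual I H × P)) :
    SmoothFormAt (bodyModel I J) (shiftedForm I J B φ) z := by
  rw [shiftedForm_eq hφ]
  exact (smoothFormAt_extD (smoothFormAt_leftTrivializedOneForm
    (contMDiff_unshiftedMomentum hφ)) z).neg.sub
      ((isSmoothForm_iff.1 hB _).pullback contMDiff_spatialMap.contMDiffAt)

lemma extD_shiftedForm (hφ : ContMDiff (I.prod J) 𝓘(ℝ, E →L[ℝ] ℝ) ∞ φ)
    (hB : IsSmoothForm (I.prod J) B) (hB_closed : ∀ z, extD (I.prod J) B z = 0)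
    (z : H × (LieDual I H × P)) :
    extD (bodyModel I J) (shiftedForm I J B φ) z = 0 := by
  have hθ := smoothFormAt_leftTrivializedOneForm (I := I) (contMDiff_unshiftedMomentum hφ)
  have hspatial : extD (bodyModel I J)
      (pullback (bodyModel I J) (I.prod J) (spatialMap I) B) z = 0 := by
    rw [extD_pullback contMDiff_spatialMap.contMDiffAt (isSmoothForm_iff.1 hB _), pullback,
      hB_closed]
    rfl
  rw [shiftedForm_eq hφ, extD_sub (smoothFormAt_extD hθ z).neg
    ((isSmoothForm_iff.1 hB _).pullback contMDiff_spatialMap.contMDiffAt), extD_neg,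
    extD_extD hθ, hspatial, neg_zero, sub_zero]

lemma pullback_leftTranslate_shiftedForm (hφ : ContMDiff (I.prod J) 𝓘(ℝ, E →L[ℝ] ℝ) ∞ φ)
    (hB : ∀ h : H, pullback (I.prod J) (I.prod J) (diagAct h : H × P → H × P) B = B) (h : H) :
    pullback (bodyModel I J) (bodyModel I J) (leftTranslate h) (shiftedForm I J B φ)
      = shiftedForm I J B φ := by
  have hspatial : pullback (bodyModel I J) (bodyModel I J) (leftTranslate h)
      (pullback (bodyModel I J) (I.prod J) (spatialMap I) B)
      = pullback (bodyModel I J) (I.prod J) (spatialMap I) B := by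
    funext z
    have hdiff := contMDiff_spatialMap (I := I) (J := J) (H := H) (P := P)
    rw [← pullback_comp ((hdiff _).mdifferentiableAt (by simp))
      ((contMDiff_leftTranslate h z).mdifferentiableAt (by simp)), spatialMap_comp_leftTranslate,
      pullback_comp ((contMDiff_diagAct h _).mdifferentiableAt (by simp))
      ((hdiff z).mdifferentiableAt (by simp)), hB]
  rw [shiftedForm_eq hφ]
  funext z
  exact congrArg₂ (fun α β : (E × (E →L[ℝ] ℝ) × F) [⋀^Fin 2]→L[ℝ] ℝ => -α - β)
    (congrFun (pullback_leftTranslate_extD_leftTrivializedOneForm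
      (contMDiff_unshiftedMomentum hφ) h) z) (congrFun hspatial z)

lemma shiftedForm_one_apply (hφ : IsBgPotential I J B φ) {ωP : DiffForm J P 2} {x : P}
    (hB : pullback J (I.prod J) (fun y : P => ((1 : H), y)) B x = -ωP x)
    (ν : LieDual I H) (ξ η : GroupLieAlgebra I H) (ρ σ : E →L[ℝ] ℝ) (u w : F) :
    shiftedForm I J B φ ((1 : H), (ν, x)) ![(ξ, ρ, u), (η, σ, w)]
      = σ ξ - ρ η + ν (⁅ξ, η⁆ : GroupLieAlgebra I H) - twoCocycle I φ ξ η (1, x)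
        + ωP x ![u, w] := by
  obtain ⟨A, hA⟩ : ∃ A : F →L[ℝ] E →L[ℝ] ℝ,
      HasMFDerivAt J 𝓘(ℝ, E →L[ℝ] ℝ) (fun y => φ (1, y)) x A :=
    ⟨_, (((hφ.smooth.comp (contMDiff_const.prodMk contMDiff_id)) x).mdifferentiableAt
      (by simp)).hasMFDerivAt⟩
  have hθ : extD (bodyModel I J)
        (leftTrivializedOneForm I (𝓘(ℝ, E →L[ℝ] ℝ).prod J) (unshiftedMomentum φ))
        ((1 : H), (ν, x)) ![(ξ, ρ, u), (η, σ, w)]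
      = (ρ η + A u η) - (σ ξ + A w ξ)
        - (ν (⁅ξ, η⁆ : GroupLieAlgebra I H) + φ (1, x) (⁅ξ, η⁆ : GroupLieAlgebra I H)) :=
    extD_leftTrivializedOneForm_one_apply (contMDiff_unshiftedMomentum hφ.smooth) (ν, x)
      (hasMFDerivAt_unshiftedMomentum hA ν) ξ η (ρ, u) (σ, w)
  have hspatial := pullback_spatialMap_apply hφ hB hA ν ξ η ρ σ u w
  refine (DFunLike.congr_fun (congrFun (shiftedForm_eq hφ.smooth) _)
    (![(ξ, ρ, u), (η, σ, w)] : Fin 2 → E × ((E →L[ℝ] ℝ) × F))).trans ?_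
  refine (congrArg₂ (fun s t : ℝ => -s - t) hθ hspatial).trans ?_
  ring

end ShiftedForm

section ReducedBracket

variable {E : Type*} [NormedAddCommGroup E] [NormedSpace ℝ E]
  {X : Type*} [TopologicalSpace X] {I : ModelWithCorners ℝ E X}
  {H : Type*} [TopologicalSpace H] [ChartedSpace X H] [Group H]
  {F : Type*} [NormedAddCommGroup F] [NormedSpace ℝ F]
  {Y : Type*} [TopologicalSpace Y] {J : ModelWithCorners ℝ F Y}
  {P : Type*} [TopologicalSpace P] [ChartedSpace Y P]

lemma mvfderiv_comp_snd {f : LieDual I H × P → ℝ}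
    (hf : ContMDiff (𝓘(ℝ, E →L[ℝ] ℝ).prod J) 𝓘(ℝ, ℝ) ∞ f) (g : H) (ν : LieDual I H) (x : P)
    (v : E) (ρ : E →L[ℝ] ℝ) (u : F) :
    mvfderiv (bodyModel I J) (f ∘ (Prod.snd : H × (LieDual I H × P) → LieDual I H × P))
        (g, (ν, x)) (v, ρ, u)
      = fderiv ℝ (fun μ => f (μ, x)) ν ρ + mvfderiv J (fun y => f (ν, y)) x u := by
  have hdiff := (hf (ν, x)).mdifferentiableAt (by simp)
  have hcomp := (HasMFDerivAt.comp (I := bodyModel I J) (f := Prod.snd) (g, (ν, x))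
    hdiff.hasMFDerivAt (hasMFDerivAt_snd _)).mfderiv
  refine (DFunLike.congr_fun hcomp (v, ρ, u)).trans ?_
  refine (mfderiv_prod_eq_add_apply hdiff).trans ?_
  exact congrArg (· + mvfderiv J (fun y => f (ν, y)) x u)
    (DFunLike.congr_fun (mfderiv_eq_fderiv (f := fun μ => f (μ, x))) ρ)

variable [LieGroup I ∞ H] [I.Boundaryless] [MulAction H P] [ContMDiffSMul I J ∞ H P]
  {B : DiffForm (I.prod J) (H × P) 2} {φ : H × P → LieDual I H}

lemma twoCocycle_zero_left (hφ : IsBgPotential I J B φ) (η : GroupLieAlgebra I H) (z : H × P) :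
    twoCocycle I φ 0 η z = 0 := by
  have hB : B z ![fundField I J 0 z, fundField I J η z] = 0 :=
    (B z).map_coord_zero 0 (map_zero _)
  rw [twoCocycle_eq hφ, hB, bracket_zero_left]
  exact (zero_sub _).trans (neg_eq_zero.2 (map_zero (φ z)))

variable [J.Boundaryless] [IsManifold J ∞ P]
  {ωP : DiffForm J P 2} {x : P}

lemma shiftedForm_apply (hφ : IsBgPotential I J B φ)
    (hB_inv : ∀ h : H, pullback (I.prod J) (I.prod J) (diagAct h : H × P → H × P) B = B)
    (hB : pullback J (I.prod J) (fun y : P => ((1 : H), y)) B x = -ωP x)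
    (g : H) (ν : LieDual I H) (ξ η : GroupLieAlgebra I H) (ρ σ : E →L[ℝ] ℝ) (u w : F) :
    shiftedForm I J B φ (g, (ν, x)) ![(leftTangent I g ξ, ρ, u), (leftTangent I g η, σ, w)]
      = σ ξ - ρ η + ν (⁅ξ, η⁆ : GroupLieAlgebra I H) - twoCocycle I φ ξ η (1, x)
        + ωP x ![u, w] := by
  have hvec : (fun i => ((leftTangentInv I g ((![(leftTangent I g ξ, ρ, u),
      (leftTangent I g η, σ, w)] : Fin 2 → E × ((E →L[ℝ] ℝ) × F)) i).1,
      ((![(leftTangent I g ξ, ρ, u), (leftTangent I g η, σ, w)] :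
        Fin 2 → E × ((E →L[ℝ] ℝ) × F)) i).2) : E × ((E →L[ℝ] ℝ) × F)))
      = ![(ξ, ρ, u), (η, σ, w)] := by
    funext i
    fin_cases i <;> exact Prod.ext (leftTangentInv_comp_leftTangent g _) rfl
  refine (apply_eq_of_pullback_leftTranslate_eq
    (pullback_leftTranslate_shiftedForm hφ.smooth hB_inv) g (ν, x) _).trans ?_
  exact (congrArg (shiftedForm I J B φ ((1 : H), (ν, x))) hvec).trans
    (shiftedForm_one_apply hφ hB ν ξ η ρ σ u w)

lemma components_of_shiftedForm_apply_eq (hφ : IsBgPotential I J B φ)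
    (hB_inv : ∀ h : H, pullback (I.prod J) (I.prod J) (diagAct h : H × P → H × P) B = B)
    (hB : pullback J (I.prod J) (fun y : P => ((1 : H), y)) B x = -ωP x)
    {g : H} {ν : LieDual I H} {ξ δ : GroupLieAlgebra I H} {ρ : E →L[ℝ] ℝ} {u : F} {d : F →L[ℝ] ℝ}
    (h : ∀ (η : GroupLieAlgebra I H) (σ : E →L[ℝ] ℝ) (w : F),
      shiftedForm I J B φ (g, (ν, x)) ![(leftTangent I g ξ, ρ, u), (leftTangent I g η, σ, w)]
        = σ δ + d w) :
    ξ = δ ∧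
      (∀ η : GroupLieAlgebra I H,
        ρ η = ν (⁅δ, η⁆ : GroupLieAlgebra I H) - twoCocycle I φ δ η (1, x)) ∧
      ∀ w : F, ωP x ![u, w] = d w := by
  have hωP : ωP x ![u, (0 : F)] = 0 := (ωP x).map_coord_zero 1 rfl
  have hbracket : ν (⁅ξ, (0 : GroupLieAlgebra I H)⁆ : GroupLieAlgebra I H) = 0 := by
    rw [bracket_swap, bracket_zero_left]
    exact (congrArg ν neg_zero).trans (map_zero ν)
  have hcocycle : twoCocycle I φ ξ 0 (1, x) = 0 := by
    rw [twoCocycle_swap hφ, twoCocycle_zero_left hφ, neg_zero]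
  have hρ : ρ (0 : GroupLieAlgebra I H) = 0 := map_zero ρ
  have hzero (ζ : GroupLieAlgebra I H) : (0 : E →L[ℝ] ℝ) ζ = 0 := rfl
  have hd : d 0 = 0 := map_zero d
  have key (η : GroupLieAlgebra I H) (σ : E →L[ℝ] ℝ) (w : F) :=
    (shiftedForm_apply hφ hB_inv hB g ν ξ η ρ σ u w).symm.trans (h η σ w)
  have hξ : ξ = δ := (SeparatingDual.eq_iff_forall_dual_eq (R := ℝ) (V := E)).2 fun σ => by
    linarith [key 0 σ 0]
  subst hξ
  refine ⟨rfl, fun η => ?_, fun w => ?_⟩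
  · linarith [key η 0 0, hzero ξ]
  · linarith [key 0 0 w, hzero ξ]

theorem isSymplectic_shiftedForm (hφ : IsBgPotential I J B φ)
    (hB_inv : ∀ h : H, pullback (I.prod J) (I.prod J) (diagAct h : H × P → H × P) B = B)
    (hB : ∀ x, pullback J (I.prod J) (fun y : P => ((1 : H), y)) B x = -ωP x)
    (hωP : IsSymplectic J ωP) (hB_smooth : IsSmoothForm (I.prod J) B)
    (hB_closed : ∀ z, extD (I.prod J) B z = 0) :
    IsSymplectic (bodyModel I J) (shiftedForm I J B φ) where
  smooth := isSmoothForm_iff.2 (smoothFormAt_shiftedForm hφ.smooth hB_smooth)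
  closed := extD_shiftedForm hφ.smooth hB_smooth hB_closed
  nondegenerate := by
    rintro ⟨g, ν, x⟩ ⟨v, ρ, u⟩ hv
    obtain ⟨ξ, rfl⟩ : ∃ ξ, leftTangent I g ξ = v := ⟨_, leftTangent_comp_leftTangentInv g v⟩
    obtain ⟨hξ, hρ, hu⟩ := components_of_shiftedForm_apply_eq (δ := 0) (d := 0) hφ hB_inv (hB x)
      fun η σ w => (hv (leftTangent I g η, σ, w)).trans
        ((congrArg (· + (0 : ℝ)) (map_zero σ)).trans (add_zero 0)).symm
    have hρ_apply (η : GroupLieAlgebra I H) : ρ η = 0 := by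
      rw [hρ, bracket_zero_left, twoCocycle_zero_left hφ, sub_zero]
      exact map_zero ν
    have hρ_zero : ρ = 0 := ContinuousLinearMap.ext hρ_apply
    have hu_zero : u = 0 := hωP.nondegenerate x u hu
    rw [hξ, hρ_zero, hu_zero, map_zero]
    rfl

variable [FiniteDimensional ℝ E] [FiniteDimensional ℝ F]

theorem isInducedBracket_naturalBracket (hφ : IsBgPotential I J B φ)
    (hB_inv : ∀ h : H, pullback (I.prod J) (I.prod J) (diagAct h : H × P → H × P) B = B)
    (hB : ∀ x, pullback J (I.prod J) (fun y : P => ((1 : H), y)) B x = -ωP x)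
    (hωP : IsSymplectic J ωP) (hΩ : IsSymplectic (bodyModel I J) (shiftedForm I J B φ)) :
    IsInducedBracket I J (shiftedForm I J B φ) (naturalBracket I J ωP φ) := by
  intro f k hf hk
  funext ⟨g, ν, x⟩
  let δf : GroupLieAlgebra I H := funDeriv I (fun μ => f (μ, x)) ν
  let δk : GroupLieAlgebra I H := funDeriv I (fun μ => k (μ, x)) ν
  obtain ⟨⟨v, ρ, u⟩, hX⟩ : ∃ X : E × ((E →L[ℝ] ℝ) × F),
      X = hamVec (bodyModel I J) (shiftedForm I J B φ) (k ∘ Prod.snd) (g, (ν, x)) := ⟨_, rfl⟩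
  obtain ⟨ξ, rfl⟩ : ∃ ξ, leftTangent I g ξ = v := ⟨_, leftTangent_comp_leftTangentInv g v⟩
  obtain ⟨-, hρ, hu⟩ := components_of_shiftedForm_apply_eq (δ := δk)
    (d := mvfderiv J (fun y => k (ν, y)) x) hφ hB_inv (hB x) (ξ := ξ) (ρ := ρ) (u := u) (ν := ν)
    (g := g) fun η σ w => by
      rw [hX, funDeriv_spec]
      exact (hamVec_spec hΩ _ _ _).trans (mvfderiv_comp_snd hk g ν x _ σ w)
  have hu_ham : u = hamVec J ωP (fun y => k (ν, y)) x := hamVec_unique hωP _ x u hu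
  have hbracket : ν (⁅δk, δf⁆ : GroupLieAlgebra I H) = -ν (⁅δf, δk⁆ : GroupLieAlgebra I H) :=
    (congrArg ν (bracket_swap δk δf)).trans (map_neg ν _)
  symm
  calc poissonBracket (bodyModel I J) (shiftedForm I J B φ) (f ∘ Prod.snd) (k ∘ Prod.snd)
        (g, (ν, x))
      = fderiv ℝ (fun μ => f (μ, x)) ν ρ + mvfderiv J (fun y => f (ν, y)) x u :=
        (congrArg (mvfderiv (bodyModel I J) (f ∘ Prod.snd) (g, (ν, x))) hX.symm).trans
          (mvfderiv_comp_snd hf g ν x _ ρ u)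
    _ = ρ δf + poissonBracket J ωP (fun y => f (ν, y)) (fun y => k (ν, y)) x := by
        rw [← funDeriv_spec, hu_ham]
        rfl
    _ = naturalBracket I J ωP φ f k (ν, x) := by
        rw [hρ, hbracket, twoCocycle_swap hφ, sub_neg_eq_add, add_right_comm]
        rfl

end ReducedBracket

end BodyReduction

end

theorem mainTheorem3
    {E : Type*} [NormedAddCommGroup E] [NormedSpace ℝ E] [FiniteDimensional ℝ E]
    {X : Type*} [TopologicalSpace X] (I : ModelWithCorners ℝ E X) [I.Boundaryless]
    {H : Type*} [TopologicalSpace H] [ChartedSpace X H] [Group H] [LieGroup I ∞ H]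
    {F : Type*} [NormedAddCommGroup F] [NormedSpace ℝ F] [FiniteDimensional ℝ F]
    {Y : Type*} [TopologicalSpace Y] (J : ModelWithCorners ℝ F Y) [J.Boundaryless]
    {P : Type*} [TopologicalSpace P] [ChartedSpace Y P] [IsManifold J ∞ P]
    [MulAction H P] [ContMDiffSMul I J ∞ H P]
    -- the symplectic form of `P`, preserved by the action of `H`
    (ωP : BodyReduction.DiffForm J P 2) (hωP : BodyReduction.IsSymplectic J ωP)
    (hωP_inv : ∀ h : H, BodyReduction.pullback J J (fun x : P => h • x) ωP = ωP)
    -- the closed invariant two-form `B` on `H × P`, with restriction `-ωP` to `P`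
    (B : BodyReduction.DiffForm (I.prod J) (H × P) 2)
    (hB_smooth : BodyReduction.IsSmoothForm (I.prod J) B)
    (hB_closed : ∀ z, BodyReduction.extD (I.prod J) B z = 0)
    (hB_restrict : ∀ (g : H) (x : P),
      BodyReduction.pullback J (I.prod J) (fun y : P => (g, y)) B x = -ωP x)
    (hB_inv : ∀ h : H, BodyReduction.pullback (I.prod J) (I.prod J)
      (BodyReduction.diagAct h : H × P → H × P) B = B)
    -- the potential of `B`
    (φ : H × P → BodyReduction.LieDual I H) (hφ : BodyReduction.IsBgPotential I J B φ) :
    BodyReduction.IsSymplectic (BodyReduction.bodyModel I J)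
        (BodyReduction.shiftedForm I J B φ) ∧
      (∀ h : H, BodyReduction.pullback (BodyReduction.bodyModel I J) (BodyReduction.bodyModel I J)
        (BodyReduction.bodyAct I h : H × (BodyReduction.LieDual I H × P) → _)
        (BodyReduction.shiftedForm I J B φ) = BodyReduction.shiftedForm I J B φ) ∧
      BodyReduction.IsInducedBracket I J (BodyReduction.shiftedForm I J B φ)
        (BodyReduction.naturalBracket I J ωP φ) := by
  have hB (x : P) := hB_restrict 1 x
  have hsymp := BodyReduction.isSymplectic_shiftedForm hφ hB_inv hB hωP hB_smooth hB_closed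
  exact ⟨hsymp, BodyReduction.pullback_leftTranslate_shiftedForm hφ.smooth hB_inv,
    BodyReduction.isInducedBracket_naturalBracket hφ hB_inv hB hωP hsymp⟩
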